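/- Let $\omega$ be a smooth Hermitian metric on $\mathbb C^n$, identified with its positive $(1,1)$-form. Write $d^c=i(\bar\partial-\partial)$, so that $dd^c=2i\,\partial\bar\partial$, and $\omega_u=\omega+dd^cu$. For $1\le m<n$ and an open set $\Omega\subset\mathbb C^n$, a real-valued function $u\in C^2(\Omega)$ is called $(\omega,m)$-subharmonic in $\Omega$ if $$\omega_u^{\,k}\wedge\omega^{n-k}\ge 0\quad\text{on }\Omega\qquad\text{for every }k=1,\dots,m.$$ **CLN inequality.** Let $U\subset\mathbb C^n$ be a relatively compact open set and let $K\subset U$ be compact. There is a constant $C=C_{K,U,\omega}>0$, depending only on $K$, $U$ and $\omega$, such that for all integers $1\le k\le m<n$, every open set $\Omega\subset\mathbb C^n$ with $\overline U\subset\Omega$, and all $(\omega,m)$-subharmonic functions $u_1,\dots,u_k\in C^2(\Omega)$, $$\int_K\omega_{u_1}\wedge\dots\wedge\omega_{u_k}\wedge\omega^{n-k}\le C\Bigl(1+\sum_{j=1}^k\|u_j\|_{L^\infty(U)}\Bigr)^k.$$ -/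

import Mathlib

open MeasureTheory Complex
open scoped ContDiff ENNReal ComplexOrder

noncomputable section

namespace CLN

/-- The real-linear, complex-valued covectors on `ℂⁿ`, that is, the complexified cotangent space
of `ℂⁿ = ℝ²ⁿ` at a point. -/
abbrev Covector (n : ℕ) : Type := (Fin n → ℂ) →ₗ[ℝ] ℂ

/-- The algebra of complex-valued exterior forms at a point; multiplication is the wedge
product. -/
abbrev Form (n : ℕ) : Type := ExteriorAlgebra ℂ (Covector n)

/-- The covector `dz_j`. -/
def dz {n : ℕ} (j : Fin n) : Covector n := LinearMap.proj j

/-- The covector `dz̄_j`. -/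
def dzbar {n : ℕ} (j : Fin n) : Covector n :=
  Complex.conjAe.toLinearMap ∘ₗ LinearMap.proj j

/-- The `(1,1)`-form `i ∑ a_{jk} dz_j ∧ dz̄_k` with coefficient matrix `a`. -/
def form11 {n : ℕ} (a : Matrix (Fin n) (Fin n) ℂ) : Form n :=
  ∑ j, ∑ k, (I * a j k) • (ExteriorAlgebra.ι ℂ (dz j) * ExteriorAlgebra.ι ℂ (dzbar k))

/-- The oriented real basis `e_1, i e_1, …, e_n, i e_n` of `ℂⁿ`. -/
def realBasis (n : ℕ) (i : Fin (n * 2)) : Fin n → ℂ :=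
  Pi.single (finProdFinEquiv.symm i).1 (if (finProdFinEquiv.symm i).2 = 0 then 1 else I)

/-- Evaluation of a covector at a vector, as a complex-linear functional of the covector. -/
def evalAt {n : ℕ} (v : Fin n → ℂ) : Covector n →ₗ[ℂ] ℂ where
  toFun α := α v
  map_add' _ _ := rfl
  map_smul' _ _ := rfl

/-- The value of an exterior form on the frame `e_1, i e_1, …, e_n, i e_n`. It sends
`α_1 ∧ … ∧ α_{2n}` to `det (α_p (b_q))`, where `b` is the frame, and vanishes on the forms of
every other degree. -/
def frameValue (n : ℕ) : Form n →ₗ[ℂ] ℂ :=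
  ExteriorAlgebra.liftAlternating (R := ℂ) (M := Covector n) (N := ℂ)
    (Pi.single (n * 2)
      (Matrix.detRowAlternating.compLinearMap (LinearMap.pi fun q => evalAt (realBasis n q))))

theorem frameValue_wedge (n : ℕ) (α : Fin (n * 2) → Covector n) :
    frameValue n (ExteriorAlgebra.ιMulti ℂ (n * 2) α) =
      Matrix.det (Matrix.of fun p q => α p (realBasis n q)) := by
  unfold frameValue
  rw [ExteriorAlgebra.liftAlternating_apply_ιMulti, Pi.single_eq_same]
  rfl

/-- The density of a real form of top degree with respect to the Euclidean volume form
`dx_1 ∧ dy_1 ∧ … ∧ dx_n ∧ dy_n`. -/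
def density {n : ℕ} (η : Form n) : ℝ := (frameValue n η).re

/-- The integral over `K` of a field of real forms of top degree. -/
def integralForm {n : ℕ} (K : Set (Fin n → ℂ)) (η : (Fin n → ℂ) → Form n) : ℝ :=
  ∫ z in K, density (η z)

/-- `∂f/∂z_j = (∂f/∂x_j - i ∂f/∂y_j) / 2`. -/
def del {n : ℕ} (j : Fin n) (f : (Fin n → ℂ) → ℂ) (z : Fin n → ℂ) : ℂ :=
  (fderiv ℝ f z (Pi.single j 1) - I * fderiv ℝ f z (Pi.single j I)) / 2

/-- `∂f/∂z̄_j = (∂f/∂x_j + i ∂f/∂y_j) / 2`. -/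
def delbar {n : ℕ} (j : Fin n) (f : (Fin n → ℂ) → ℂ) (z : Fin n → ℂ) : ℂ :=
  (fderiv ℝ f z (Pi.single j 1) + I * fderiv ℝ f z (Pi.single j I)) / 2

/-- The complex Hessian `∂²u/∂z_j∂z̄_k` of a real-valued function. -/
def complexHessian {n : ℕ} (u : (Fin n → ℂ) → ℝ) (z : Fin n → ℂ) : Matrix (Fin n) (Fin n) ℂ :=
  Matrix.of fun j k => del j (delbar k fun w => (u w : ℂ)) z

/-- `dd^c u = 2i ∂∂̄u = 2i ∑ ∂²u/∂z_j∂z̄_k dz_j ∧ dz̄_k`, where `d^c = i (∂̄ - ∂)`. -/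
def ddc {n : ℕ} (u : (Fin n → ℂ) → ℝ) (z : Fin n → ℂ) : Form n :=
  (2 : ℂ) • form11 (complexHessian u z)

/-- A smooth Hermitian metric on `ℂⁿ`, given by its coefficient matrix. -/
structure HermitianMetric (n : ℕ) where
  coeff : (Fin n → ℂ) → Matrix (Fin n) (Fin n) ℂ
  smooth : ∀ j k, ContDiff ℝ ∞ fun z => coeff z j k
  posDef : ∀ z, (coeff z).PosDef

/-- The positive `(1,1)`-form `ω = i ∑ g_{jk} dz_j ∧ dz̄_k` of the Hermitian metric
`g`. -/
def HermitianMetric.form {n : ℕ} (g : HermitianMetric n) (z : Fin n → ℂ) : Form n :=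
  form11 (g.coeff z)

/-- `ω_u = ω + dd^c u`, where `ω` is the form of `g`. -/
def HermitianMetric.twist {n : ℕ} (g : HermitianMetric n) (u : (Fin n → ℂ) → ℝ)
    (z : Fin n → ℂ) : Form n :=
  g.form z + ddc u z

/-- `u` is of class `C²` and `(ω, m)`-subharmonic on the open set `Ω`, where `ω` is the form of
`g`: the form `ω_u ^ k ∧ ω ^ (n - k)` is nonnegative at every point of `Ω` for `k = 1, …, m`. -/
structure IsC2Subharmonic {n : ℕ} (g : HermitianMetric n) (m : ℕ) (Ω : Set (Fin n → ℂ))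
    (u : (Fin n → ℂ) → ℝ) : Prop where
  contDiffOn : ContDiffOn ℝ 2 u Ω
  nonneg : ∀ k, 1 ≤ k → k ≤ m → ∀ z ∈ Ω,
    0 ≤ density (g.twist u z ^ k * g.form z ^ (n - k))

/-- The norm of `u` in `L^∞(U)` with respect to Lebesgue measure. -/
def supNorm {n : ℕ} (U : Set (Fin n → ℂ)) (u : (Fin n → ℂ) → ℝ) : ℝ :=
  (eLpNorm u ∞ (volume.restrict U)).toReal

end CLN

end

/-!
The proof reduces the inequality to powers of a single function and treats these by induction on
the power, with integration by parts.

*The pointwise part.* On the real frame, `ω_u ^ k ∧ ω ^ (n - k)` is a mixed discriminant of the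
coefficient matrices (`density_pow_mul_pow`). Diagonalizing a Hermitian matrix `A` and the metric
`g` by the same congruence turns it into an elementary symmetric function of the eigenvalues of `A`
relative to `g` (`mixedDisc_congr_diag`), so that `(ω, m)`-subharmonicity says that the coefficient
matrix lies in the Gårding cone of order `m` (`InCone`). Two facts about this cone are used. It is
convex: for vectors this is the superadditivity of the quotients of consecutive elementary symmetric
functions (`OpenCone.add_and_superadditive`), and for matrices one compares, in coordinates that
diagonalize the sum, the eigenvalues of the summands with their diagonals, by Birkhoff's theorem
(`InCone.add`). And for `r < m` all coefficients of the `r`-th exterior power of `A` are controlled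
by the mixed discriminant of order `r` (`InCone.norm_altSum_le`); for vectors this follows by
splitting off the largest entry (`OpenCone.abs_prod_le`), since deleting an entry costs one order of
the cone, by Newton's inequality (`OpenCone.erase`).

*The estimate for one function.* Let `φ` be a cut-off function. In
`∫ φ ω_v ^ k ∧ ω ^ (n - k)` one factor `ω_v` is written as `ω + dd^c v`. The part with `ω` has a
lower power of `ω_v`. In the other part the remaining factors `ω_v` are expanded into powers of
`ω` and `dd^c v`; since `dd^c v` is closed, integration by parts moves both derivatives of one
factor `dd^c v` to the product of `φ` and a power of `ω` (`integral_altSum_hess`). As `ω` is not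
closed, derivatives of `ω` appear there, but the result is still a smooth test form. Writing
`dd^c v = ω_v - ω` again, one obtains `v` times coefficients of powers of `ω_v` of order at most
`k - 1 < m`, times a smooth form. These coefficients are controlled by the nonnegative densities of
`ω_v ^ r ∧ ω ^ (n - r)` with `r < k`, to which the induction hypothesis applies
(`exists_setIntegral_mixedDisc_le`).

*Several functions.* By polarization, `k!` times the wedge product of the `ω_{u_j}` is an alternating
sum of the powers of `∑_{j ∈ T} ω_{u_j}`, and this sum is `|T|` times `ω_v` for the average `v` of
the `u_j`. By convexity of the cone, `v` is again `(ω, m)`-subharmonic, and it is bounded by the sum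
of the norms of the `u_j` (`setIntegral_density_prod_le`).
-/

open MeasureTheory Complex
open scoped ContDiff ENNReal ComplexOrder

noncomputable section

namespace CLN

/-! ### Real-rooted polynomials and Newton's inequality -/

section Newton

open Polynomial

theorem splits_derivative_real {f : ℝ[X]} (hf : f.Splits) : f.derivative.Splits := by
  rw [splits_iff_card_roots] at hf ⊢
  refine le_antisymm (card_roots' _) ?_
  have h1 := card_roots_le_derivative f
  have h2 := natDegree_derivative_le f
  omega

/-- Where `f` does not vanish, this says that the logarithmic derivative of `f` decreases. -/
theorem eval_mul_eval_derivative_two_le {f : ℝ[X]} (hf : f.Splits) (t : ℝ) :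
    f.eval t * (derivative (derivative f)).eval t ≤ (derivative f).eval t ^ 2 := by
  have key : ∀ s : Multiset ℝ,
      ((s.map fun a => X - C a).prod).eval t *
        (derivative (derivative (s.map fun a => X - C a).prod)).eval t ≤
          (derivative (s.map fun a => X - C a).prod).eval t ^ 2 := by
    intro s
    induction s using Multiset.induction with
    | empty => simp
    | cons a s ih =>
      rw [Multiset.map_cons, Multiset.prod_cons]
      set q := (s.map fun a => X - C a).prod
      simp only [derivative_mul, derivative_add, derivative_sub, derivative_X, derivative_C,
        eval_mul, eval_add, eval_sub, eval_X, eval_C, sub_zero, one_mul]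
      nlinarith [sq_nonneg (q.eval t), mul_le_mul_of_nonneg_left ih (sq_nonneg (t - a))]
  rw [hf.eq_prod_roots]
  set q := (f.roots.map fun a => X - C a).prod with hq
  have := key f.roots
  rw [← hq] at this
  simp only [derivative_C_mul, eval_mul, eval_C]
  nlinarith [mul_le_mul_of_nonneg_left this (sq_nonneg f.leadingCoeff)]

/-- Newton's inequality for the coefficients of a real-rooted polynomial, without the factor that
depends on the degree. -/
theorem newton_coeff {f : ℝ[X]} (hf : f.Splits) (k : ℕ) :
    ((k : ℝ) + 2) * (f.coeff k * f.coeff (k + 2)) ≤ ((k : ℝ) + 1) * f.coeff (k + 1) ^ 2 := by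
  induction k generalizing f with
  | zero =>
    have := eval_mul_eval_derivative_two_le hf 0
    simp only [← coeff_zero_eq_eval_zero, coeff_derivative] at this
    norm_num at this ⊢
    linarith
  | succ k ih =>
    have := ih (splits_derivative_real hf)
    simp only [coeff_derivative] at this
    push_cast at this ⊢
    have h : ((k : ℝ) + 1) * (k + 2) * ((k + 3) * (f.coeff (k + 1) * f.coeff (k + 3))) ≤
        (k + 1) * (k + 2) * ((k + 2) * f.coeff (k + 2) ^ 2) := by
      ring_nf at this ⊢
      linarith
    have := le_of_mul_le_mul_left h (by positivity)
    rw [show (k : ℝ) + 1 + 2 = k + 3 by ring, show (k : ℝ) + 1 + 1 = k + 2 by ring]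
    exact this

end Newton

/-! ### The Gårding cones of vectors -/

section Cone

variable {ι : Type*}

/-- The `k`-th elementary symmetric function of the numbers `x i`, `i ∈ s`. -/
def elem (s : Finset ι) (k : ℕ) (x : ι → ℝ) : ℝ := ∑ t ∈ s.powersetCard k, ∏ i ∈ t, x i

@[simp] theorem elem_zero (s : Finset ι) (x : ι → ℝ) : elem s 0 x = 1 := by simp [elem]

theorem elem_empty_succ (k : ℕ) (x : ι → ℝ) : elem (∅ : Finset ι) (k + 1) x = 0 := by
  rw [elem, Finset.powersetCard_eq_empty.2 (by simp), Finset.sum_empty]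

theorem elem_one (s : Finset ι) (x : ι → ℝ) : elem s 1 x = ∑ i ∈ s, x i := by
  simp [elem, Finset.powersetCard_one]

/-- The open Gårding cone of order `m` of the numbers `x i`, `i ∈ s`. The condition for `k = 0`
holds trivially. -/
def OpenCone (s : Finset ι) (m : ℕ) (x : ι → ℝ) : Prop := ∀ k ≤ m, 0 < elem s k x

/-- The closed Gårding cone of order `m` of the numbers `x i`, `i ∈ s`. -/
def ClosedCone (s : Finset ι) (m : ℕ) (x : ι → ℝ) : Prop := ∀ k ≤ m, 0 ≤ elem s k x

theorem OpenCone.mono {s : Finset ι} {m m' : ℕ} {x : ι → ℝ} (h : OpenCone s m x) (hm : m' ≤ m) :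
    OpenCone s m' x := fun k hk => h k (hk.trans hm)

@[fun_prop] theorem continuous_elem (s : Finset ι) (k : ℕ) : Continuous (elem s k) := by
  unfold elem
  fun_prop

theorem elem_smul (s : Finset ι) (k : ℕ) (c : ℝ) (x : ι → ℝ) :
    elem s k (c • x) = c ^ k * elem s k x := by
  unfold elem
  rw [Finset.mul_sum]
  refine Finset.sum_congr rfl fun t ht => ?_
  simp [Finset.prod_mul_distrib, (Finset.mem_powersetCard.1 ht).2]

theorem elem_univ_comp_perm [Fintype ι] (k : ℕ) (x : ι → ℝ) (σ : Equiv.Perm ι) :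
    elem Finset.univ k (x ∘ σ) = elem Finset.univ k x := by
  unfold elem
  refine Finset.sum_bij' (fun t _ => t.map σ.toEmbedding) (fun t _ => t.map σ.symm.toEmbedding)
    ?_ ?_ ?_ ?_ ?_
  · intro t ht; simpa [Finset.mem_powersetCard] using ht
  · intro t ht; simpa [Finset.mem_powersetCard] using ht
  · intro t _; ext; simp
  · intro t _; ext; simp
  · intro t _; simp

theorem tendsto_elem_shift (s : Finset ι) (k : ℕ) (x : ι → ℝ) :
    Filter.Tendsto (fun t : ℝ => elem s k (fun i => x i + t)) (nhdsWithin 0 (Set.Ioi 0))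
      (nhds (elem s k x)) := by
  have : Continuous fun t : ℝ => elem s k (fun i => x i + t) :=
    (continuous_elem s k).comp (by fun_prop)
  have h := this.tendsto 0
  simp only [add_zero] at h
  exact h.mono_left nhdsWithin_le_nhds

theorem ClosedCone.smul {s : Finset ι} {m : ℕ} {x : ι → ℝ} (hx : ClosedCone s m x) {c : ℝ}
    (hc : 0 ≤ c) : ClosedCone s m (c • x) := fun k hk => by
  rw [elem_smul]
  exact mul_nonneg (pow_nonneg hc k) (hx k hk)

variable [DecidableEq ι]

theorem elem_insert {s : Finset ι} {i : ι} (hi : i ∉ s) (k : ℕ) (x : ι → ℝ) :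
    elem (insert i s) (k + 1) x = elem s (k + 1) x + x i * elem s k x := by
  unfold elem
  have hmem : ∀ t ∈ s.powersetCard k, i ∉ t := fun t ht h =>
    hi ((Finset.mem_powersetCard.1 ht).1 h)
  rw [Finset.powersetCard_succ_insert hi, Finset.sum_union, Finset.sum_image, Finset.mul_sum]
  · congr 1
    exact Finset.sum_congr rfl fun t ht => Finset.prod_insert (hmem t ht)
  · intro t ht t' ht' h
    have := congrArg (fun r => r.erase i) h
    simpa [Finset.erase_insert (hmem t ht), Finset.erase_insert (hmem t' ht')] using this
  · rw [Finset.disjoint_left]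
    intro t ht ht'
    obtain ⟨r, -, rfl⟩ := Finset.mem_image.1 ht'
    exact hi ((Finset.mem_powersetCard.1 ht).1 (Finset.mem_insert_self _ _))

theorem elem_eq_erase {s : Finset ι} {i : ι} (hi : i ∈ s) (k : ℕ) (x : ι → ℝ) :
    elem s (k + 1) x = elem (s.erase i) (k + 1) x + x i * elem (s.erase i) k x := by
  conv_lhs => rw [← Finset.insert_erase hi]
  exact elem_insert (Finset.notMem_erase i s) k x

/-- The elementary symmetric functions are the coefficients of `∏ (1 + x i X)`, which is
real-rooted. -/
theorem elem_newton (s : Finset ι) (k : ℕ) (x : ι → ℝ) :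
    elem s k x * elem s (k + 2) x ≤ elem s (k + 1) x ^ 2 := by
  open Polynomial in
  have hc : ∀ (s : Finset ι) (k : ℕ), (∏ i ∈ s, (1 + C (x i) * X)).coeff k = elem s k x := by
    intro s
    induction s using Finset.induction with
    | empty =>
      intro k
      cases k with
      | zero => simp
      | succ k => simp [elem_empty_succ, coeff_one]
    | insert i s hi ih =>
      intro k
      rw [Finset.prod_insert hi, add_mul, one_mul, mul_assoc, coeff_add, coeff_C_mul, ih]
      cases k with
      | zero => simp
      | succ k => rw [coeff_X_mul, ih, elem_insert hi]
  open Polynomial in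
  have hs : (∏ i ∈ s, (1 + C (x i) * X)).Splits := by
    refine Splits.prod fun i _ => Splits.of_natDegree_le_one ?_
    compute_degree
  have := newton_coeff hs k
  rw [hc, hc, hc] at this
  have hk : (0 : ℝ) ≤ k := Nat.cast_nonneg k
  by_contra! hlt
  nlinarith [sq_nonneg (elem s (k + 1) x)]

/-- Deleting an entry lowers the order of the cone by one. If the deleted function of order `k + 1`
were nonpositive, the two recursions next to it would contradict Newton's inequality. -/
theorem OpenCone.erase {s : Finset ι} {m : ℕ} {x : ι → ℝ} (h : OpenCone s (m + 1) x) {i : ι}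
    (hi : i ∈ s) : OpenCone (s.erase i) m x := by
  intro k
  induction k with
  | zero => intro _; simp
  | succ k ih =>
    intro hk
    have h0 := ih (by omega)
    have h1 := h (k + 1) (by omega)
    have h2 := h (k + 2) (by omega)
    rw [elem_eq_erase hi] at h1 h2
    have hN := elem_newton (s.erase i) k x
    by_contra! hneg
    set a := elem (s.erase i) k x
    set b := elem (s.erase i) (k + 1) x
    set c := elem (s.erase i) (k + 2) x
    have hx : 0 < x i := by
      by_contra! hx
      nlinarith
    have : (-b) * (-(x i * b)) < (x i * a) * c := by
      apply mul_lt_mul'' <;> nlinarith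
    nlinarith

/-- In the cone of order `k + 1`, products of `k` entries are controlled by the `k`-th elementary
symmetric function: split off the largest entry. -/
theorem OpenCone.abs_prod_le {N : ℕ} (k : ℕ) {s : Finset ι} {x : ι → ℝ} (hs : s.card ≤ N)
    (h : OpenCone s (k + 1) x) {t : Finset ι} (ht : t ∈ s.powersetCard k) :
    |∏ i ∈ t, x i| ≤ (N : ℝ) ^ k * elem s k x := by
  induction k generalizing s t with
  | zero =>
    have : t = ∅ := by simpa using ht
    simp [this]
  | succ k ih =>
    obtain ⟨hts, htc⟩ := Finset.mem_powersetCard.1 ht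
    have hne : s.Nonempty := by
      rw [Finset.nonempty_iff_ne_empty]
      rintro rfl
      have := h 1 (by omega)
      simp [elem_one] at this
    obtain ⟨j, hj, hmax⟩ := s.exists_max_image x hne
    have hsum : 0 < ∑ i ∈ s, x i := by
      have := h 1 (by omega)
      rwa [elem_one] at this
    have hxj : 0 < x j := by
      by_contra! hxj
      exact absurd hsum (not_lt.2 (Finset.sum_nonpos fun i hi => (hmax i hi).trans hxj))
    have hNpos : (1 : ℝ) ≤ N := by
      exact_mod_cast (Finset.card_pos.2 hne).trans_le hs
    have habs : ∀ l ∈ s, |x l| ≤ N * x j := by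
      intro l hl
      rw [abs_le]
      constructor
      · have h1 : ∑ i ∈ s.erase l, x i ≤ ∑ i ∈ s.erase l, x j :=
          Finset.sum_le_sum fun i hi => hmax i (Finset.mem_of_mem_erase hi)
        rw [Finset.sum_const, nsmul_eq_mul] at h1
        have h2 := Finset.add_sum_erase s x hl
        have h3 : ((s.erase l).card : ℝ) ≤ N := by
          exact_mod_cast (Finset.card_erase_le).trans hs
        nlinarith
      · nlinarith [hmax l hl]
    have hcone := h.erase hj
    have hcard : (s.erase j).card ≤ N := Finset.card_erase_le.trans hs
    have helem : x j * elem (s.erase j) k x ≤ elem s (k + 1) x := by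
      rw [elem_eq_erase hj]
      have := hcone (k + 1) le_rfl
      linarith
    have hNk : (0 : ℝ) ≤ (N : ℝ) ^ k := by positivity
    obtain ⟨l, hl, hle, hsub⟩ : ∃ l ∈ t, |x l| ≤ N * x j ∧ t.erase l ⊆ s.erase j := by
      by_cases hjt : j ∈ t
      · exact ⟨j, hjt, habs j hj, Finset.erase_subset_erase _ hts⟩
      · obtain ⟨l, hl⟩ : t.Nonempty := Finset.card_pos.1 (by omega)
        refine ⟨l, hl, habs l (hts hl), fun i hi => ?_⟩
        have hit := Finset.mem_of_mem_erase hi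
        exact Finset.mem_erase.2 ⟨fun h => hjt (h ▸ hit), hts hit⟩
    have hih := ih hcard hcone (t := t.erase l)
      (Finset.mem_powersetCard.2 ⟨hsub, by rw [Finset.card_erase_of_mem hl]; omega⟩)
    rw [← Finset.mul_prod_erase t x hl, abs_mul]
    calc |x l| * |∏ i ∈ t.erase l, x i|
        ≤ (N * x j) * ((N : ℝ) ^ k * elem (s.erase j) k x) :=
          mul_le_mul hle hih (abs_nonneg _) (by positivity)
      _ = (N : ℝ) ^ (k + 1) * (x j * elem (s.erase j) k x) := by ring
      _ ≤ (N : ℝ) ^ (k + 1) * elem s (k + 1) x :=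
          mul_le_mul_of_nonneg_left helem (by positivity)

theorem sum_mul_elem_erase (s : Finset ι) (k : ℕ) (x : ι → ℝ) :
    ∑ i ∈ s, x i * elem (s.erase i) k x = (k + 1) * elem s (k + 1) x := by
  have h : ∀ i ∈ s, x i * elem (s.erase i) k x =
      ∑ t ∈ s.powersetCard (k + 1), if i ∈ t then ∏ j ∈ t, x j else 0 := by
    intro i hi
    have h1 : ∑ t ∈ s.powersetCard (k + 1), (if i ∈ t then ∏ j ∈ t, x j else 0) =
        elem s (k + 1) x - elem (s.erase i) (k + 1) x := by
      rw [eq_sub_iff_add_eq, elem, elem]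
      have : (s.erase i).powersetCard (k + 1) = (s.powersetCard (k + 1)).filter (i ∉ ·) := by
        ext t
        simp only [Finset.mem_powersetCard, Finset.mem_filter, Finset.subset_erase]
        tauto
      rw [this, Finset.sum_filter, ← Finset.sum_add_distrib]
      refine Finset.sum_congr rfl fun t _ => ?_
      by_cases hit : i ∈ t <;> simp [hit]
    rw [h1, elem_eq_erase hi]
    ring
  rw [Finset.sum_congr rfl h, Finset.sum_comm, elem, Finset.mul_sum]
  refine Finset.sum_congr rfl fun t ht => ?_
  obtain ⟨hts, htc⟩ := Finset.mem_powersetCard.1 ht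
  rw [← Finset.sum_filter, Finset.filter_mem_eq_inter, Finset.inter_eq_right.2 hts,
    Finset.sum_const, htc, nsmul_eq_mul]
  push_cast
  ring

theorem sub_sq_div_superadditive {a b r s q : ℝ} (har : 0 < a + r) (hbs : 0 < b + s)
    (hq : r + s ≤ q) :
    (a - a ^ 2 / (a + r)) + (b - b ^ 2 / (b + s)) ≤ (a + b) - (a + b) ^ 2 / (a + b + q) := by
  have h1 : (a + b) ^ 2 / (a + b + q) ≤ (a + b) ^ 2 / ((a + r) + (b + s)) :=
    div_le_div_of_nonneg_left (sq_nonneg _) (by linarith) (by linarith)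
  have h2 : (a + b) ^ 2 / ((a + r) + (b + s)) ≤ a ^ 2 / (a + r) + b ^ 2 / (b + s) := by
    rw [div_add_div _ _ har.ne' hbs.ne', div_le_div_iff₀ (by linarith) (by positivity)]
    nlinarith [sq_nonneg (a * (b + s) - b * (a + r))]
  linarith

/-- The quotient of two consecutive elementary symmetric functions, in terms of the quotients for
the families with one entry deleted. -/
theorem elem_div_elem {s : Finset ι} {m : ℕ} {x : ι → ℝ} (h : OpenCone s (m + 1) x) :
    ((m : ℝ) + 2) * (elem s (m + 2) x / elem s (m + 1) x) =
      ∑ i ∈ s, (x i - x i ^ 2 / (x i + elem (s.erase i) (m + 1) x / elem (s.erase i) m x)) := by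
  have h0 := (h (m + 1) le_rfl).ne'
  have hs := sum_mul_elem_erase s (m + 1) x
  push_cast at hs
  have hs' : ((m : ℝ) + 2) * elem s (m + 2) x = ∑ i ∈ s, x i * elem (s.erase i) (m + 1) x := by
    rw [hs]; ring
  rw [← mul_div_assoc, hs', Finset.sum_div]
  refine Finset.sum_congr rfl fun i hi => ?_
  have h1 := (h.erase hi m le_rfl).ne'
  have h2 := elem_eq_erase hi m x
  have h3 : x i + elem (s.erase i) (m + 1) x / elem (s.erase i) m x =
      elem s (m + 1) x / elem (s.erase i) m x := by
    rw [h2]; field_simp; ring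
  rw [h3]
  field_simp
  rw [h2]; ring

/-- The open cones are closed under addition, and the quotient of consecutive elementary symmetric
functions is superadditive on them (Marcus and Lopes). -/
theorem OpenCone.add_and_superadditive (m : ℕ) {s : Finset ι} {x y : ι → ℝ}
    (hx : OpenCone s (m + 1) x) (hy : OpenCone s (m + 1) y) :
    OpenCone s (m + 1) (x + y) ∧
      elem s (m + 1) x / elem s m x + elem s (m + 1) y / elem s m y ≤
        elem s (m + 1) (x + y) / elem s m (x + y) := by
  induction m generalizing s with
  | zero =>
    have h : elem s 1 (x + y) = elem s 1 x + elem s 1 y := by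
      simp [elem_one, Finset.sum_add_distrib]
    refine ⟨fun k hk => ?_, by simp [h]⟩
    interval_cases k
    · simp
    · have h1 := hx 1 (by omega)
      have h2 := hy 1 (by omega)
      simp only [h]
      linarith
  | succ m ih =>
    obtain ⟨hadd, -⟩ := ih (hx.mono (by omega)) (hy.mono (by omega))
    have hle : elem s (m + 2) x / elem s (m + 1) x + elem s (m + 2) y / elem s (m + 1) y ≤
        elem s (m + 2) (x + y) / elem s (m + 1) (x + y) := by
      have hm : (0 : ℝ) < (m : ℝ) + 2 := by positivity
      refine le_of_mul_le_mul_left ?_ hm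
      rw [mul_add, elem_div_elem (hx.mono (by omega)), elem_div_elem (hy.mono (by omega)),
        elem_div_elem hadd, ← Finset.sum_add_distrib]
      refine Finset.sum_le_sum fun i hi => ?_
      have hpos : ∀ z : ι → ℝ, OpenCone s (m + 2) z →
          0 < z i + elem (s.erase i) (m + 1) z / elem (s.erase i) m z := by
        intro z hz
        have h1 := (hz.erase hi) m (by omega)
        have h2 := hz (m + 1) (by omega)
        rw [elem_eq_erase hi] at h2
        have h3 : z i + elem (s.erase i) (m + 1) z / elem (s.erase i) m z =
            (elem (s.erase i) (m + 1) z + z i * elem (s.erase i) m z) /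
              elem (s.erase i) m z := by
          field_simp; ring
        rw [h3]
        positivity
      exact sub_sq_div_superadditive (hpos x hx) (hpos y hy) (ih (hx.erase hi) (hy.erase hi)).2
    refine ⟨fun k hk => ?_, hle⟩
    rcases Nat.lt_or_ge k (m + 2) with hk' | hk'
    · exact hadd k (by omega)
    · obtain rfl : k = m + 2 := by omega
      have hx1 : 0 < elem s (m + 2) x / elem s (m + 1) x :=
        div_pos (hx _ le_rfl) (hx _ (by omega))
      have hy1 : 0 < elem s (m + 2) y / elem s (m + 1) y :=
        div_pos (hy _ le_rfl) (hy _ (by omega))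
      have hd := hadd (m + 1) le_rfl
      have : 0 < elem s (m + 2) (x + y) / elem s (m + 1) (x + y) := by linarith
      have := mul_pos this hd
      rwa [div_mul_cancel₀ _ hd.ne'] at this

theorem OpenCone.add {m : ℕ} {s : Finset ι} {x y : ι → ℝ}
    (hx : OpenCone s m x) (hy : OpenCone s m y) : OpenCone s m (x + y) := by
  cases m with
  | zero =>
    intro k hk
    obtain rfl : k = 0 := by omega
    simp
  | succ m => exact (OpenCone.add_and_superadditive m hx hy).1

theorem hasDerivAt_elem_shift (s : Finset ι) (k : ℕ) (x : ι → ℝ) (t : ℝ) :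
    HasDerivAt (fun t : ℝ => elem s (k + 1) (fun i => x i + t))
      (((s.card : ℝ) - k) * elem s k (fun i => x i + t)) t := by
  induction s using Finset.induction generalizing k with
  | empty =>
    cases k with
    | zero => simpa [elem_empty_succ] using hasDerivAt_const t (0 : ℝ)
    | succ k => simpa [elem_empty_succ] using hasDerivAt_const t (0 : ℝ)
  | insert i s hi ih =>
    have hfun : (fun t : ℝ => elem (insert i s) (k + 1) (fun i => x i + t)) =
        fun t => elem s (k + 1) (fun i => x i + t) + (x i + t) * elem s k (fun i => x i + t) := by
      funext t
      exact elem_insert hi k _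
    rw [hfun, Finset.card_insert_of_notMem hi]
    have hid : HasDerivAt (fun t : ℝ => x i + t) 1 t := (hasDerivAt_id t).const_add _
    cases k with
    | zero =>
      simp only [elem_zero, mul_one]
      refine ((ih 0).add hid).congr_deriv ?_
      simp
    | succ k =>
      refine ((ih (k + 1)).add (hid.mul (ih k))).congr_deriv ?_
      rw [elem_insert hi]
      push_cast
      ring

/-- Shifting all entries by `t` moves the closed cone into the open cone, because the derivative in
`t` of an elementary symmetric function is a positive multiple of the preceding one. -/
theorem ClosedCone.openCone_shift {s : Finset ι} {m : ℕ} {x : ι → ℝ} (h : ClosedCone s m x)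
    (hm : m ≤ s.card) {t : ℝ} (ht : 0 < t) : OpenCone s m (fun i => x i + t) := by
  intro k
  induction k generalizing t with
  | zero => intro _; simp
  | succ k ih =>
    intro hk
    have hmono : StrictMonoOn (fun t : ℝ => elem s (k + 1) (fun i => x i + t)) (Set.Ici 0) := by
      refine strictMonoOn_of_deriv_pos (convex_Ici 0)
        (fun t _ => (hasDerivAt_elem_shift s k x t).continuousAt.continuousWithinAt) ?_
      intro t ht
      rw [interior_Ici] at ht
      rw [(hasDerivAt_elem_shift s k x t).deriv]
      have : (k : ℝ) < s.card := by exact_mod_cast hk.trans hm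
      exact mul_pos (by linarith) (ih ht (by omega))
    have h1 := hmono (Set.mem_Ici.2 le_rfl) (Set.mem_Ici.2 ht.le) ht
    have h2 := h (k + 1) hk
    simp only [add_zero] at h1
    linarith

theorem ClosedCone.add {s : Finset ι} {m : ℕ} {x y : ι → ℝ} (hx : ClosedCone s m x)
    (hy : ClosedCone s m y) (hm : m ≤ s.card) : ClosedCone s m (x + y) := by
  intro k hk
  have : Continuous fun t : ℝ => elem s k ((fun i => x i + t) + fun i => y i + t) :=
    (continuous_elem s k).comp (by fun_prop)
  have h := this.tendsto 0
  simp only [add_zero] at h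
  refine ge_of_tendsto (h.mono_left (nhdsWithin_le_nhds (s := Set.Ioi 0))) ?_
  filter_upwards [self_mem_nhdsWithin] with t ht
  exact (((hx.openCone_shift hm ht).add (hy.openCone_shift hm ht)) k hk).le

theorem ClosedCone.sum {s : Finset ι} {m : ℕ} (hm : m ≤ s.card) {κ : Type*} (T : Finset κ)
    {x : κ → ι → ℝ} (hx : ∀ j ∈ T, ClosedCone s m (x j)) : ClosedCone s m (∑ j ∈ T, x j) := by
  classical
  refine Finset.sum_induction x (ClosedCone s m) (fun a b ha hb => ha.add hb hm) ?_ hx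
  intro k _
  cases k with
  | zero => simp
  | succ k =>
    have := elem_smul s (k + 1) 0 0
    simp only [zero_smul] at this
    rw [this]
    simp

theorem ClosedCone.abs_prod_le {s : Finset ι} {k m : ℕ} {x : ι → ℝ} (h : ClosedCone s m x)
    (hkm : k < m) (hm : m ≤ s.card) {t : Finset ι} (ht : t ∈ s.powersetCard k) :
    |∏ i ∈ t, x i| ≤ (s.card : ℝ) ^ k * elem s k x := by
  have h1 : Continuous fun a : ℝ => |∏ i ∈ t, (x i + a)| := by fun_prop
  have h1' := h1.tendsto 0
  simp only [add_zero] at h1'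
  refine le_of_tendsto_of_tendsto (h1'.mono_left (nhdsWithin_le_nhds (s := Set.Ioi 0)))
    ((tendsto_elem_shift s k x).const_mul _) ?_
  filter_upwards [self_mem_nhdsWithin] with a ha
  exact ((h.openCone_shift hm ha).mono hkm).abs_prod_le k le_rfl ht

end Cone

/-! ### Alternating sums and mixed discriminants -/

section Mixed

open Equiv Matrix

variable {n : ℕ}

/-- The sum of `Φ σ τ` over all pairs of permutations, weighted with the product of the two
signs. -/
def altSum (Φ : Perm (Fin n) → Perm (Fin n) → ℂ) : ℂ :=
  ∑ σ, ∑ τ, ((Perm.sign σ : ℤ) : ℂ) * ((Perm.sign τ : ℤ) : ℂ) * Φ σ τ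

theorem altSum_swap_left (Φ : Perm (Fin n) → Perm (Fin n) → ℂ) {i j : Fin n} (hij : i ≠ j) :
    altSum (fun σ τ => Φ (σ * swap i j) τ) = -altSum Φ := by
  unfold altSum
  rw [← Finset.sum_neg_distrib,
    ← Fintype.sum_equiv (Equiv.mulRight (swap i j)) _ _ (fun σ => rfl)]
  refine Finset.sum_congr rfl fun σ _ => ?_
  rw [← Finset.sum_neg_distrib]
  refine Finset.sum_congr rfl fun τ _ => ?_
  simp [Perm.sign_mul, Perm.sign_swap hij]

theorem altSum_comm (Φ : Perm (Fin n) → Perm (Fin n) → ℂ) :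
    altSum (fun σ τ => Φ τ σ) = altSum Φ := by
  unfold altSum
  rw [Finset.sum_comm]
  exact Finset.sum_congr rfl fun σ _ => Finset.sum_congr rfl fun τ _ => by ring

/-- An alternating sum whose terms do not change under a transposition of two slots vanishes. -/
theorem altSum_eq_zero_left {Φ : Perm (Fin n) → Perm (Fin n) → ℂ} {i j : Fin n} (hij : i ≠ j)
    (h : ∀ σ τ, Φ (σ * swap i j) τ = Φ σ τ) : altSum Φ = 0 := by
  have h1 := altSum_swap_left Φ hij
  simp only [h] at h1
  exact self_eq_neg.1 h1

theorem altSum_congr {Φ Ψ : Perm (Fin n) → Perm (Fin n) → ℂ} (h : ∀ σ τ, Φ σ τ = Ψ σ τ) :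
    altSum Φ = altSum Ψ := by
  have : Φ = Ψ := funext fun σ => funext fun τ => h σ τ
  rw [this]

theorem altSum_add (Φ Ψ : Perm (Fin n) → Perm (Fin n) → ℂ) :
    altSum (fun σ τ => Φ σ τ + Ψ σ τ) = altSum Φ + altSum Ψ := by
  simp only [altSum, mul_add, Finset.sum_add_distrib]

theorem altSum_mul_left (c : ℂ) (Φ : Perm (Fin n) → Perm (Fin n) → ℂ) :
    altSum (fun σ τ => c * Φ σ τ) = c * altSum Φ := by
  simp only [altSum, Finset.mul_sum]
  exact Finset.sum_congr rfl fun σ _ => Finset.sum_congr rfl fun τ _ => by ring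

theorem altSum_sum {κ : Type*} (T : Finset κ) (Φ : κ → Perm (Fin n) → Perm (Fin n) → ℂ) :
    altSum (fun σ τ => ∑ a ∈ T, Φ a σ τ) = ∑ a ∈ T, altSum (Φ a) := by
  classical
  induction T using Finset.induction with
  | empty => simp [altSum]
  | insert a T ha ih =>
    simp only [Finset.sum_insert ha, altSum_add, ih]

theorem norm_altSum_le {Φ : Perm (Fin n) → Perm (Fin n) → ℂ} {B : ℝ} (h : ∀ σ τ, ‖Φ σ τ‖ ≤ B) :
    ‖altSum Φ‖ ≤ (n.factorial : ℝ) ^ 2 * B := by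
  have hterm : ∀ σ τ : Perm (Fin n),
      ‖((Perm.sign σ : ℤ) : ℂ) * ((Perm.sign τ : ℤ) : ℂ) * Φ σ τ‖ ≤ B := by
    intro σ τ
    rcases Int.units_eq_one_or (Perm.sign σ) with h1 | h1 <;>
    rcases Int.units_eq_one_or (Perm.sign τ) with h2 | h2 <;>
    simpa [h1, h2] using h σ τ
  calc ‖altSum Φ‖ ≤ ∑ _σ : Perm (Fin n), ∑ _τ : Perm (Fin n), B := by
        refine (norm_sum_le _ _).trans (Finset.sum_le_sum fun σ _ => ?_)
        exact (norm_sum_le _ _).trans (Finset.sum_le_sum fun τ _ => hterm σ τ)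
    _ = (n.factorial : ℝ) ^ 2 * B := by
        simp only [Finset.sum_const, Finset.card_univ, Fintype.card_perm, Fintype.card_fin,
          nsmul_eq_mul]
        ring

/-- The alternating sum of a product over the slots splits into two determinants. -/
theorem altSum_prod_mul_prod (M N : Matrix (Fin n) (Fin n) ℂ) :
    altSum (fun σ τ => (∏ i, M i (σ i)) * ∏ i, N i (τ i)) = M.det * N.det := by
  rw [← det_transpose M, ← det_transpose N, det_apply', det_apply', Finset.sum_mul_sum]
  simp only [altSum, transpose_apply]
  exact Finset.sum_congr rfl fun σ _ => Finset.sum_congr rfl fun τ _ => by ring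

/-- The mixed discriminant of two matrices, the first in the slots in `S`, the second in the other
slots. -/
def mixedDisc (S : Finset (Fin n)) (A g : Matrix (Fin n) (Fin n) ℂ) : ℂ :=
  altSum fun σ τ => (∏ i ∈ S, A (σ i) (τ i)) * ∏ i ∈ Sᶜ, g (σ i) (τ i)

/-- The sum over all permutations of the products of the permuted entries with index in `S` is a
positive multiple of the elementary symmetric function. -/
theorem exists_sum_perm_prod_eq (S : Finset (Fin n)) :
    ∃ c : ℝ, 1 ≤ c ∧ ∀ l : Fin n → ℝ,
      ∑ r : Perm (Fin n), ∏ i ∈ S, l (r i) = c * elem Finset.univ S.card l := by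
  set fib : Finset (Fin n) → Finset (Perm (Fin n)) := fun T =>
    Finset.univ.filter fun r => S.map r.toEmbedding = T with hfib
  have hcard : ∀ T : Finset (Fin n), T.card = S.card → (fib T).card = (fib S).card := by
    intro T hT
    obtain ⟨e⟩ : Nonempty (S ≃ T) := ⟨Finset.equivOfCardEq hT.symm⟩
    set π : Perm (Fin n) := e.extendSubtype with hπ
    have hST : S.map π.toEmbedding = T := by
      refine Finset.eq_of_subset_of_card_le ?_ (by simp [hT])
      intro a ha
      obtain ⟨b, hb, rfl⟩ := Finset.mem_map.1 ha
      exact Equiv.extendSubtype_mem e b hb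
    symm
    refine Finset.card_bij (fun r _ => π * r) ?_ ?_ ?_
    · intro r hr
      simp only [hfib, Finset.mem_filter, Finset.mem_univ, true_and] at hr ⊢
      have : S.map (π * r).toEmbedding = (S.map r.toEmbedding).map π.toEmbedding := by
        rw [Finset.map_map]; rfl
      rw [this, hr, hST]
    · intro a _ b _ hab
      exact mul_left_cancel hab
    · intro r hr
      refine ⟨π⁻¹ * r, ?_, by simp⟩
      simp only [hfib, Finset.mem_filter, Finset.mem_univ, true_and] at hr ⊢
      have : S.map (π⁻¹ * r).toEmbedding = (S.map r.toEmbedding).map (π⁻¹).toEmbedding := by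
        rw [Finset.map_map]; rfl
      have h1 : π.toEmbedding.trans (π⁻¹ : Perm (Fin n)).toEmbedding =
          Function.Embedding.refl _ := by ext; simp
      rw [this, hr, ← hST, Finset.map_map, h1, Finset.map_refl]
  refine ⟨(fib S).card, ?_, fun l => ?_⟩
  · have : 0 < (fib S).card := Finset.card_pos.2 ⟨1, by
      simp only [hfib, Finset.mem_filter, Finset.mem_univ, true_and]
      exact Finset.map_refl⟩
    exact_mod_cast this
  · rw [elem, Finset.mul_sum, ← Finset.sum_fiberwise_of_maps_to
      (g := fun r : Perm (Fin n) => S.map r.toEmbedding)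
      (t := Finset.univ.powersetCard S.card) (by intro r _; simp [Finset.mem_powersetCard])]
    refine Finset.sum_congr rfl fun T hT => ?_
    rw [← hcard T (Finset.mem_powersetCard.1 hT).2, ← nsmul_eq_mul, ← Finset.sum_const]
    refine Finset.sum_congr rfl fun r hr => ?_
    have hr' := (Finset.mem_filter.1 hr).2
    rw [← hr', Finset.prod_map]
    rfl

theorem exists_unitary_diag {A : Matrix (Fin n) (Fin n) ℂ} (hA : A.IsHermitian) :
    ∃ V : Matrix (Fin n) (Fin n) ℂ, Vᴴ * V = 1 ∧ V * Vᴴ = 1 ∧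
      A = V * diagonal (fun i => (hA.eigenvalues i : ℂ)) * Vᴴ := by
  have h : (hA.eigenvectorUnitary : Matrix (Fin n) (Fin n) ℂ)ᴴ * hA.eigenvectorUnitary = 1 :=
    Unitary.coe_star_mul_self _
  refine ⟨hA.eigenvectorUnitary, h, mul_eq_one_comm.1 h, ?_⟩
  conv_lhs => rw [hA.spectral_theorem, Unitary.conjStarAlgAut_apply]
  rfl

/-- A Hermitian matrix and a positive definite one are diagonalized by the same congruence. -/
theorem exists_simultaneous_diag {A g : Matrix (Fin n) (Fin n) ℂ} (hg : g.PosDef)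
    (hA : A.IsHermitian) :
    ∃ (P : Matrix (Fin n) (Fin n) ℂ) (l : Fin n → ℝ),
      IsUnit P.det ∧ g = Pᴴ * P ∧ A = Pᴴ * diagonal (fun i => (l i : ℂ)) * P := by
  obtain ⟨Q, hQ, hgQ⟩ : ∃ Q : Matrix (Fin n) (Fin n) ℂ, IsUnit Q.det ∧ g = Qᴴ * Q := by
    obtain ⟨W, hW, hW', hgW⟩ := exists_unitary_diag hg.1
    have hpos := hg.eigenvalues_pos
    refine ⟨diagonal (fun i => ((√(hg.1.eigenvalues i) : ℝ) : ℂ)) * Wᴴ, ?_, ?_⟩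
    · rw [det_mul, det_diagonal]
      refine IsUnit.mul (IsUnit.mk0 _ (Finset.prod_ne_zero_iff.2 fun i _ => ?_))
        (isUnit_det_of_left_inverse hW')
      exact_mod_cast (Real.sqrt_pos.2 (hpos i)).ne'
    · conv_lhs => rw [hgW]
      rw [conjTranspose_mul, conjTranspose_conjTranspose, diagonal_conjTranspose,
        Matrix.mul_assoc, Matrix.mul_assoc, ← Matrix.mul_assoc (diagonal _) (diagonal _),
        diagonal_mul_diagonal]
      congr 3
      funext i
      simp only [Pi.star_apply, Complex.star_def, Complex.conj_ofReal]
      rw [← Complex.ofReal_mul, Real.mul_self_sqrt (hpos i).le]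
  set R := Q⁻¹ with hR
  have hRQ : R * Q = 1 := nonsing_inv_mul Q hQ
  have hB : (Rᴴ * A * R).IsHermitian := isHermitian_conjTranspose_mul_mul R hA
  obtain ⟨V, hVV, hVV', hspec⟩ := exists_unitary_diag hB
  generalize hB.eigenvalues = l at hspec
  refine ⟨Vᴴ * Q, l, ?_, ?_, ?_⟩
  · rw [det_mul]
    exact ((isUnit_det_of_left_inverse hVV').mul hQ)
  · rw [conjTranspose_mul, conjTranspose_conjTranspose, Matrix.mul_assoc, ← Matrix.mul_assoc V,
      hVV', Matrix.one_mul, hgQ]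
  · have hQR : Qᴴ * Rᴴ = 1 := by
      rw [← conjTranspose_mul, hRQ, conjTranspose_one]
    calc A = (Qᴴ * Rᴴ) * A * (R * Q) := by rw [hQR, hRQ]; simp
      _ = Qᴴ * (Rᴴ * A * R) * Q := by simp only [Matrix.mul_assoc]
      _ = _ := by
        rw [hspec, conjTranspose_mul, conjTranspose_conjTranspose]
        simp only [Matrix.mul_assoc]

theorem congr_diag_apply (P : Matrix (Fin n) (Fin n) ℂ) (l : Fin n → ℝ) (a b : Fin n) :
    (Pᴴ * diagonal (fun i => (l i : ℂ)) * P) a b = ∑ r, (l r : ℂ) * (star (P r a) * P r b) := by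
  rw [mul_apply]
  refine Finset.sum_congr rfl fun r _ => ?_
  rw [mul_diagonal, conjTranspose_apply]
  ring

theorem congr_apply (P : Matrix (Fin n) (Fin n) ℂ) (a b : Fin n) :
    (Pᴴ * P) a b = ∑ r, star (P r a) * P r b := by
  simp [mul_apply]

/-- The mixed discriminant of a pair of matrices diagonalized by the same congruence. -/
theorem mixedDisc_congr_diag (S : Finset (Fin n)) (P : Matrix (Fin n) (Fin n) ℂ)
    (l : Fin n → ℝ) :
    mixedDisc S (Pᴴ * diagonal (fun i => (l i : ℂ)) * P) (Pᴴ * P) =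
      ((‖P.det‖ ^ 2 * ∑ r : Perm (Fin n), ∏ i ∈ S, l (r i) : ℝ) : ℂ) := by
  classical
  have hterm : ∀ σ τ : Perm (Fin n),
      (∏ i ∈ S, (Pᴴ * diagonal (fun i => (l i : ℂ)) * P) (σ i) (τ i)) *
        ∏ i ∈ Sᶜ, (Pᴴ * P) (σ i) (τ i) =
      ∑ r : Fin n → Fin n, (∏ i ∈ S, (l (r i) : ℂ)) *
        ((∏ i, star (P (r i) (σ i))) * ∏ i, P (r i) (τ i)) := by
    intro σ τ
    have h1 : ∀ i : Fin n, (if i ∈ S then (Pᴴ * diagonal (fun i => (l i : ℂ)) * P) (σ i) (τ i)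
        else (Pᴴ * P) (σ i) (τ i)) =
        ∑ r, (if i ∈ S then (l r : ℂ) else 1) * (star (P r (σ i)) * P r (τ i)) := by
      intro i
      by_cases hi : i ∈ S
      · simp only [hi, if_true, congr_diag_apply]
      · simp only [hi, if_false, congr_apply, one_mul]
    have h2 : ∀ f h : Fin n → ℂ, (∏ i ∈ S, f i) * ∏ i ∈ Sᶜ, h i =
        ∏ i, if i ∈ S then f i else h i := by
      intro f h
      rw [← Finset.prod_mul_prod_compl S]
      congr 1
      · exact Finset.prod_congr rfl fun i hi => by simp [hi]
      · exact Finset.prod_congr rfl fun i hi => by simp [Finset.mem_compl.1 hi]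
    rw [h2]
    simp only [h1]
    rw [Finset.prod_univ_sum, Fintype.piFinset_univ]
    refine Finset.sum_congr rfl fun r _ => ?_
    rw [Finset.prod_mul_distrib, Finset.prod_mul_distrib, Finset.prod_ite_mem,
      Finset.univ_inter]
  rw [mixedDisc, altSum_congr hterm, altSum_sum]
  simp only [altSum_mul_left]
  have hdet : ∀ r : Fin n → Fin n,
      altSum (fun σ τ => (∏ i, star (P (r i) (σ i))) * ∏ i, P (r i) (τ i)) =
        ((‖(P.submatrix r id).det‖ ^ 2 : ℝ) : ℂ) := by
    intro r
    have := altSum_prod_mul_prod ((P.submatrix r id).map star) (P.submatrix r id)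
    simp only [map_apply, submatrix_apply, id] at this
    rw [this]
    have h3 : ((P.submatrix r id).map star).det = star (P.submatrix r id).det := by
      rw [← det_conjTranspose, conjTranspose, transpose_map, det_transpose]
    rw [h3, Complex.star_def, mul_comm, Complex.mul_conj, Complex.normSq_eq_norm_sq]
  simp only [hdet]
  have hinj : ∀ r : Fin n → Fin n, r ∉ Set.range (fun e : Perm (Fin n) => (e : Fin n → Fin n)) →
      (∏ i ∈ S, (l (r i) : ℂ)) * ((‖(P.submatrix r id).det‖ ^ 2 : ℝ) : ℂ) = 0 := by
    intro r hr
    have : ¬ Function.Injective r := fun h =>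
      hr ⟨Equiv.ofBijective r (Finite.injective_iff_bijective.1 h), rfl⟩
    obtain ⟨i, j, hij, hne⟩ := by simpa [Function.Injective] using this
    rw [det_zero_of_row_eq hne (by funext a; simp [hij])]
    simp
  rw [← Finset.sum_subset (Finset.subset_univ
    (Finset.univ.map ⟨fun e : Perm (Fin n) => (e : Fin n → Fin n), DFunLike.coe_injective⟩))
    (fun r _ hr => hinj r (by simpa using hr)), Finset.sum_map]
  push_cast
  rw [Finset.mul_sum]
  refine Finset.sum_congr rfl fun e _ => ?_
  simp only [Function.Embedding.coeFn_mk]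
  rw [det_permute]
  rcases Int.units_eq_one_or (Perm.sign e) with h1 | h1 <;> simp [h1] <;> ring

/-! ### The Gårding cones of Hermitian matrices -/

/-- The closed Gårding cone of order `m` of Hermitian matrices, relative to `g`. The mixed
discriminant of `A` in the slots in `S` is, up to a positive factor, the elementary symmetric
function of order `|S|` of the eigenvalues of `A` relative to `g`. -/
structure InCone (g : Matrix (Fin n) (Fin n) ℂ) (m : ℕ) (A : Matrix (Fin n) (Fin n) ℂ) :
    Prop where
  isHermitian : A.IsHermitian
  nonneg : ∀ S : Finset (Fin n), S.card ≤ m → 0 ≤ (mixedDisc S A g).re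

theorem inCone_congr_diag_iff {P : Matrix (Fin n) (Fin n) ℂ} (hP : IsUnit P.det) {m : ℕ}
    (hm : m ≤ n) {l : Fin n → ℝ} :
    InCone (Pᴴ * P) m (Pᴴ * diagonal (fun i => (l i : ℂ)) * P) ↔
      ClosedCone Finset.univ m l := by
  have hpos : 0 < ‖P.det‖ ^ 2 := by have := norm_pos_iff.2 hP.ne_zero; positivity
  constructor
  · intro h k hk
    obtain ⟨S, -, hS⟩ := Finset.exists_subset_card_eq (s := (Finset.univ : Finset (Fin n)))
      (n := k) (by simpa using hk.trans hm)
    obtain ⟨c, hc, hc'⟩ := exists_sum_perm_prod_eq S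
    have := h.nonneg S (hS ▸ hk)
    rw [mixedDisc_congr_diag, Complex.ofReal_re, hc', hS] at this
    have hcp : 0 < ‖P.det‖ ^ 2 * c := by positivity
    rw [← mul_assoc] at this
    exact nonneg_of_mul_nonneg_right this hcp
  · intro h
    refine ⟨isHermitian_conjTranspose_mul_mul P
      (isHermitian_diagonal_of_self_adjoint _ (by ext i; simp)), fun S hS => ?_⟩
    obtain ⟨c, hc, hc'⟩ := exists_sum_perm_prod_eq S
    rw [mixedDisc_congr_diag, Complex.ofReal_re, hc']
    have := h S.card hS
    positivity

/-- The diagonal of a matrix unitarily equivalent to a diagonal matrix in the cone lies in the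
cone: it is obtained from the eigenvalues by a doubly stochastic matrix, which is a convex
combination of permutations by Birkhoff's theorem. -/
theorem ClosedCone.diag {m : ℕ} (hm : m ≤ n) {l : Fin n → ℝ} (hl : ClosedCone Finset.univ m l)
    {V : Matrix (Fin n) (Fin n) ℂ} (hV : Vᴴ * V = 1) :
    ClosedCone Finset.univ m (fun a => ∑ r, l r * ‖V r a‖ ^ 2) := by
  have hV' : V * Vᴴ = 1 := mul_eq_one_comm.1 hV
  set M : Matrix (Fin n) (Fin n) ℝ := Matrix.of fun a r => ‖V r a‖ ^ 2 with hM
  have hMem : M ∈ doublyStochastic ℝ (Fin n) := by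
    rw [mem_doublyStochastic_iff_sum]
    refine ⟨fun i j => by simp [hM], fun a => ?_, fun r => ?_⟩
    · have := congrFun (congrFun hV a) a
      rw [mul_apply, one_apply_eq] at this
      have h2 := congrArg Complex.re this
      simpa [hM, conjTranspose_apply, ← Complex.normSq_eq_conj_mul_self,
        ← Complex.normSq_eq_norm_sq] using h2
    · have := congrFun (congrFun hV' r) r
      rw [mul_apply, one_apply_eq] at this
      have h2 := congrArg Complex.re this
      simpa [hM, conjTranspose_apply, Complex.mul_conj,
        ← Complex.normSq_eq_norm_sq] using h2
  obtain ⟨w, hw0, -, hw⟩ := exists_eq_sum_perm_of_mem_doublyStochastic hMem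
  have hfun : (fun a => ∑ r, l r * ‖V r a‖ ^ 2) = ∑ σ : Perm (Fin n), w σ • (l ∘ σ) := by
    funext a
    have h1 : ∀ r, ‖V r a‖ ^ 2 = ∑ σ : Perm (Fin n), w σ * if σ a = r then 1 else 0 := by
      intro r
      have := congrFun (congrFun hw a) r
      rw [Matrix.sum_apply] at this
      simp only [hM, of_apply, Matrix.smul_apply, smul_eq_mul] at this
      rw [← this]
      refine Finset.sum_congr rfl fun σ _ => ?_
      congr 1
      simp [Perm.permMatrix, PEquiv.toMatrix_apply, Equiv.toPEquiv, eq_comm]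
    simp only [h1, Finset.mul_sum, Finset.sum_apply, Pi.smul_apply, Function.comp, smul_eq_mul]
    rw [Finset.sum_comm]
    refine Finset.sum_congr rfl fun σ _ => ?_
    simp [mul_comm]
  rw [hfun]
  refine ClosedCone.sum (by simpa using hm) _ fun σ _ => ?_
  refine ClosedCone.smul (fun k hk => ?_) (hw0 σ)
  rw [elem_univ_comp_perm]
  exact hl k hk

/-- In coordinates in which `g` becomes the identity, the diagonal of a matrix in the cone lies in
the cone. -/
theorem InCone.closedCone_diag {P : Matrix (Fin n) (Fin n) ℂ} (hP : IsUnit P.det) {m : ℕ}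
    (hm : m ≤ n) {B : Matrix (Fin n) (Fin n) ℂ} (hB : B.IsHermitian)
    (h : InCone (Pᴴ * P) m (Pᴴ * B * P)) : ClosedCone Finset.univ m (fun a => (B a a).re) := by
  obtain ⟨V, hVV, hVV', hspec⟩ := exists_unitary_diag hB
  set l := hB.eigenvalues
  have hQ : IsUnit (Vᴴ * P).det := by
    rw [det_mul]
    exact (isUnit_det_of_left_inverse hVV').mul hP
  have h1 : (Vᴴ * P)ᴴ * (Vᴴ * P) = Pᴴ * P := by
    rw [conjTranspose_mul, conjTranspose_conjTranspose, Matrix.mul_assoc, ← Matrix.mul_assoc V,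
      hVV', Matrix.one_mul]
  have h2 : (Vᴴ * P)ᴴ * diagonal (fun i => (l i : ℂ)) * (Vᴴ * P) = Pᴴ * B * P := by
    conv_rhs => rw [hspec]
    rw [conjTranspose_mul, conjTranspose_conjTranspose]
    simp only [Matrix.mul_assoc]
  rw [← h1, ← h2, inCone_congr_diag_iff hQ hm] at h
  have h3 := h.diag hm (V := Vᴴ) (by rwa [conjTranspose_conjTranspose])
  convert h3 using 2 with a
  conv_lhs => rw [hspec]
  rw [mul_apply, Complex.re_sum]
  refine Finset.sum_congr rfl fun r _ => ?_
  simp only [mul_diagonal, conjTranspose_apply, norm_star]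
  rw [mul_right_comm, Complex.star_def, Complex.mul_conj, ← Complex.ofReal_mul,
    Complex.ofReal_re, Complex.normSq_eq_norm_sq, mul_comm]

/-- The cone of matrices is convex: in coordinates that diagonalize the sum, the two diagonals lie
in the cone of vectors. -/
theorem InCone.add {A B g : Matrix (Fin n) (Fin n) ℂ} (hg : g.PosDef) {m : ℕ} (hm : m ≤ n)
    (hA : InCone g m A) (hB : InCone g m B) : InCone g m (A + B) := by
  obtain ⟨P, l, hP, rfl, hAB⟩ := exists_simultaneous_diag hg (hA.1.add hB.1)
  set R := P⁻¹ with hR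
  have hRP : R * P = 1 := nonsing_inv_mul P hP
  have hPR : P * R = 1 := mul_nonsing_inv P hP
  have hPR' : Pᴴ * Rᴴ = 1 := by rw [← conjTranspose_mul, hRP, conjTranspose_one]
  have hRP' : Rᴴ * Pᴴ = 1 := by rw [← conjTranspose_mul, hPR, conjTranspose_one]
  have hback : ∀ C : Matrix (Fin n) (Fin n) ℂ, Pᴴ * (Rᴴ * C * R) * P = C := by
    intro C
    calc Pᴴ * (Rᴴ * C * R) * P = (Pᴴ * Rᴴ) * C * (R * P) := by simp only [Matrix.mul_assoc]
      _ = C := by rw [hPR', hRP]; simp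
  have hA' := InCone.closedCone_diag hP hm (isHermitian_conjTranspose_mul_mul R hA.1)
    (by rwa [hback])
  have hB' := InCone.closedCone_diag hP hm (isHermitian_conjTranspose_mul_mul R hB.1)
    (by rwa [hback])
  have hdiag : Rᴴ * A * R + Rᴴ * B * R = diagonal (fun i => (l i : ℂ)) := by
    rw [← Matrix.add_mul, ← Matrix.mul_add, hAB]
    calc Rᴴ * (Pᴴ * diagonal (fun i => (l i : ℂ)) * P) * R
        = (Rᴴ * Pᴴ) * diagonal (fun i => (l i : ℂ)) * (P * R) := by
          simp only [Matrix.mul_assoc]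
      _ = _ := by rw [hRP', hPR]; simp
  rw [hAB, inCone_congr_diag_iff hP hm]
  have := hA'.add hB' (by simpa using hm)
  convert this using 1
  funext a
  have h := congrArg Complex.re (congrFun (congrFun hdiag a) a)
  simpa using h.symm

theorem mixedDisc_smul (S : Finset (Fin n)) (c : ℂ) (A g : Matrix (Fin n) (Fin n) ℂ) :
    mixedDisc S (c • A) g = c ^ S.card * mixedDisc S A g := by
  rw [mixedDisc, mixedDisc, ← altSum_mul_left]
  refine altSum_congr fun σ τ => ?_
  simp [Finset.prod_mul_distrib, mul_assoc]

theorem InCone.smul {A g : Matrix (Fin n) (Fin n) ℂ} {m : ℕ} (hA : InCone g m A) {c : ℝ}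
    (hc : 0 ≤ c) : InCone g m ((c : ℂ) • A) := by
  refine ⟨?_, fun S hS => ?_⟩
  · have := hA.1
    rw [IsHermitian, conjTranspose_smul, this.eq]
    simp
  · rw [mixedDisc_smul, ← Complex.ofReal_pow, Complex.re_ofReal_mul]
    exact mul_nonneg (pow_nonneg hc _) (hA.nonneg S hS)

/-- The coefficients of the exterior power of order `|R|` of a matrix in the cone of a larger order
are controlled by the mixed discriminant of order `|R|`. The function `Ψ` plays the role of a
test form in the slots off `R`. -/
theorem InCone.norm_altSum_le {A g : Matrix (Fin n) (Fin n) ℂ} (hg : g.PosDef) {m : ℕ}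
    (hm : m ≤ n) (hA : InCone g m A) {R : Finset (Fin n)} (hR : R.card < m) {G δ B : ℝ}
    (hG : ∀ a, ‖g a a‖ ≤ G) (hδ : 0 < δ) (hdet : δ ≤ ‖g.det‖) {Ψ : Perm (Fin n) → Perm (Fin n) → ℂ}
    (hB : ∀ σ τ, ‖Ψ σ τ‖ ≤ B)
    (hΨ : ∀ i ∈ R, ∀ j ∈ R, ∀ σ τ, Ψ (σ * swap i j) τ = Ψ σ τ) :
    ‖altSum fun σ τ => (∏ i ∈ R, A (σ i) (τ i)) * Ψ σ τ‖ ≤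
      ((n : ℝ) ^ R.card * n ^ R.card * n.factorial ^ 2 * G ^ R.card / δ) * B *
        (mixedDisc R A g).re := by
  obtain ⟨P, l, hP, rfl, rfl⟩ := exists_simultaneous_diag hg hA.1
  rw [inCone_congr_diag_iff hP hm] at hA
  have hB0 : 0 ≤ B := (norm_nonneg _).trans (hB 1 1)
  have hPG : ∀ r a, ‖P r a‖ ^ 2 ≤ G := by
    intro r a
    refine le_trans ?_ (hG a)
    rw [congr_apply]
    have : ∑ r, star (P r a) * P r a = ((∑ r, ‖P r a‖ ^ 2 : ℝ) : ℂ) := by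
      push_cast
      refine Finset.sum_congr rfl fun r _ => ?_
      rw [Complex.star_def, ← Complex.normSq_eq_conj_mul_self, Complex.normSq_eq_norm_sq]
      push_cast; rfl
    rw [this, Complex.norm_real, Real.norm_eq_abs]
    exact (Finset.single_le_sum (f := fun r => ‖P r a‖ ^ 2) (fun r _ => by positivity)
      (Finset.mem_univ r)).trans (le_abs_self _)
  have hPPG : ∀ r a b, ‖star (P r a) * P r b‖ ≤ G := by
    intro r a b
    rw [norm_mul, norm_star]
    nlinarith [hPG r a, hPG r b, sq_nonneg (‖P r a‖ - ‖P r b‖)]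
  have hterm : ∀ σ τ : Perm (Fin n),
      (∏ i ∈ R, (Pᴴ * diagonal (fun i => (l i : ℂ)) * P) (σ i) (τ i)) * Ψ σ τ =
      ∑ r : R → Fin n, (∏ i, (l (r i) : ℂ)) *
        ((∏ i : R, (star (P (r i) (σ i)) * P (r i) (τ i))) * Ψ σ τ) := by
    intro σ τ
    rw [← Finset.prod_coe_sort]
    simp only [congr_diag_apply]
    rw [Finset.prod_univ_sum, Fintype.piFinset_univ, Finset.sum_mul]
    refine Finset.sum_congr rfl fun r _ => ?_
    rw [Finset.prod_mul_distrib]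
    ring
  rw [altSum_congr hterm, altSum_sum]
  simp only [altSum_mul_left]
  have hE : 0 ≤ elem Finset.univ R.card l := hA _ hR.le
  have hbound : ∀ r : R → Fin n, ‖(∏ i, (l (r i) : ℂ)) * altSum (fun σ τ =>
      (∏ i : R, (star (P (r i) (σ i)) * P (r i) (τ i))) * Ψ σ τ)‖ ≤
      ((n : ℝ) ^ R.card * elem Finset.univ R.card l) *
        (n.factorial ^ 2 * (G ^ R.card * B)) := by
    intro r
    by_cases hr : Function.Injective r
    · rw [norm_mul]
      refine mul_le_mul ?_ ?_ (norm_nonneg _) (by positivity)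
      · have h1 := hA.abs_prod_le hR (by simpa using hm)
          (t := Finset.univ.map ⟨r, hr⟩) (by simp [Finset.mem_powersetCard])
        rw [Finset.prod_map, Finset.card_univ, Fintype.card_fin] at h1
        rw [← Complex.ofReal_prod, Complex.norm_real, Real.norm_eq_abs]
        exact h1
      · refine CLN.norm_altSum_le fun σ τ => ?_
        rw [norm_mul, norm_prod]
        refine mul_le_mul ?_ (hB σ τ) (norm_nonneg _) ?_
        · calc _ ≤ ∏ _i : R, G := Finset.prod_le_prod (fun _ _ => norm_nonneg _)
                fun i _ => hPPG _ _ _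
            _ = G ^ R.card := by simp
        · rcases R.eq_empty_or_nonempty with h | ⟨i, hi⟩
          · simp [h]
          · exact pow_nonneg ((norm_nonneg _).trans (hG i)) _
    · obtain ⟨i, j, hij, hne⟩ : ∃ i j, r i = r j ∧ i ≠ j := by
        simpa [Function.Injective] using hr
      -- Equal indices in two slots make the terms symmetric in these slots.
      rw [altSum_eq_zero_left (i := (i : Fin n)) (j := (j : Fin n))
        (fun h => hne (Subtype.ext h))]
      · rw [mul_zero, norm_zero]
        have hG0 : 0 ≤ G := (norm_nonneg _).trans (hG i)
        positivity
      · intro σ τ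
        rw [hΨ i i.2 j j.2]
        congr 1
        rw [Finset.prod_mul_distrib, Finset.prod_mul_distrib]
        congr 1
        rw [← Equiv.prod_comp (swap i j)]
        refine Finset.prod_congr rfl fun k _ => ?_
        have hk : r (swap i j k) = r k := by
          rcases eq_or_ne k i with rfl | hki
          · rw [swap_apply_left, hij]
          rcases eq_or_ne k j with rfl | hkj
          · rw [swap_apply_right, hij]
          · rw [swap_apply_of_ne_of_ne hki hkj]
        have hk' : (swap (i : Fin n) j) ((swap i j k : R) : Fin n) = k := by
          rcases eq_or_ne k i with rfl | hki
          · rw [swap_apply_left, swap_apply_right]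
          rcases eq_or_ne k j with rfl | hkj
          · rw [swap_apply_right, swap_apply_left]
          · rw [swap_apply_of_ne_of_ne hki hkj, swap_apply_of_ne_of_ne
              (fun h => hki (Subtype.ext h)) (fun h => hkj (Subtype.ext h))]
        rw [hk, Perm.mul_apply, hk']
  obtain ⟨c, hc, hc'⟩ := exists_sum_perm_prod_eq R
  have hdet' : ‖(Pᴴ * P).det‖ = ‖P.det‖ ^ 2 := by
    rw [det_mul, det_conjTranspose, norm_mul, norm_star, sq]
  rw [mixedDisc_congr_diag, Complex.ofReal_re, hc']
  rw [hdet'] at hdet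
  have hG0 : 0 ≤ G ^ R.card := by
    rcases R.eq_empty_or_nonempty with h | ⟨i, hi⟩
    · simp [h]
    · exact pow_nonneg ((norm_nonneg _).trans (hG i)) _
  calc _ ≤ ∑ _r : R → Fin n, ((n : ℝ) ^ R.card * elem Finset.univ R.card l) *
        (n.factorial ^ 2 * (G ^ R.card * B)) :=
        (norm_sum_le _ _).trans (Finset.sum_le_sum fun r _ => hbound r)
    _ = ((n : ℝ) ^ R.card * n ^ R.card * n.factorial ^ 2 * G ^ R.card / δ) * B *
        (δ * elem Finset.univ R.card l) := by
        simp only [Finset.sum_const, Finset.card_univ, Fintype.card_fun, Fintype.card_fin,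
          Fintype.card_coe, nsmul_eq_mul]
        field_simp
        push_cast
        ring
    _ ≤ _ := by
        refine mul_le_mul_of_nonneg_left ?_ (by positivity)
        calc δ * elem Finset.univ R.card l ≤ ‖P.det‖ ^ 2 * elem Finset.univ R.card l :=
              mul_le_mul_of_nonneg_right hdet hE
          _ ≤ ‖P.det‖ ^ 2 * (c * elem Finset.univ R.card l) := by
              refine mul_le_mul_of_nonneg_left ?_ (by positivity)
              nlinarith

end Mixed

/-! ### Wedge products of `(1,1)`-forms -/

section Forms

open Equiv Matrix

variable {n : ℕ}

theorem form11_add (A B : Matrix (Fin n) (Fin n) ℂ) : form11 (A + B) = form11 A + form11 B := by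
  simp only [form11, Matrix.add_apply, mul_add, add_smul, Finset.sum_add_distrib]

theorem form11_smul (c : ℂ) (A : Matrix (Fin n) (Fin n) ℂ) : form11 (c • A) = c • form11 A := by
  simp only [form11, Matrix.smul_apply, smul_eq_mul, Finset.smul_sum, smul_smul]
  refine Finset.sum_congr rfl fun j _ => Finset.sum_congr rfl fun k _ => ?_
  congr 1
  ring

/-- `form11` as a linear map. -/
def form11Hom (n : ℕ) : Matrix (Fin n) (Fin n) ℂ →ₗ[ℂ] Form n where
  toFun := form11
  map_add' := form11_add
  map_smul' := form11_smul

theorem form11_sum {κ : Type*} (T : Finset κ) (A : κ → Matrix (Fin n) (Fin n) ℂ) :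
    form11 (∑ j ∈ T, A j) = ∑ j ∈ T, form11 (A j) :=
  map_sum (form11Hom n) A T

theorem commute_ι_mul_ι (a b c d : Covector n) :
    Commute (ExteriorAlgebra.ι ℂ a * ExteriorAlgebra.ι ℂ b)
      (ExteriorAlgebra.ι ℂ c * ExteriorAlgebra.ι ℂ d) := by
  have h : ∀ x y : Covector n, ExteriorAlgebra.ι ℂ x * ExteriorAlgebra.ι ℂ y =
      -(ExteriorAlgebra.ι ℂ y * ExteriorAlgebra.ι ℂ x) := fun x y =>
    eq_neg_of_add_eq_zero_left (ExteriorAlgebra.ι_add_mul_swap x y)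
  have h1 : ∀ x : Covector n, Commute (ExteriorAlgebra.ι ℂ a * ExteriorAlgebra.ι ℂ b)
      (ExteriorAlgebra.ι ℂ x) := by
    intro x
    rw [Commute, SemiconjBy, mul_assoc, h b x, mul_neg, ← mul_assoc, h a x, neg_mul, neg_neg,
      mul_assoc]
  exact (h1 c).mul_right (h1 d)

theorem commute_form11 (A B : Matrix (Fin n) (Fin n) ℂ) : Commute (form11 A) (form11 B) := by
  unfold form11
  refine Commute.sum_left _ _ _ fun j _ => Commute.sum_left _ _ _ fun k _ =>
    Commute.sum_right _ _ _ fun j' _ => Commute.sum_right _ _ _ fun k' _ => ?_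
  exact ((commute_ι_mul_ι _ _ _ _).smul_left _).smul_right _

/-- The `0/1` matrix with a one in the column `j i` of row `i`. -/
def selectMatrix (j : Fin n → Fin n) : Matrix (Fin n) (Fin n) ℂ :=
  Matrix.of fun i l => if j i = l then 1 else 0

theorem sum_mul_det_selectMatrix (F : (Fin n → Fin n) → ℂ) :
    ∑ j, F j * (selectMatrix j).det = ∑ σ : Perm (Fin n), F σ * ((Perm.sign σ : ℤ) : ℂ) := by
  have hzero : ∀ j : Fin n → Fin n,
      j ∉ Set.range (fun e : Perm (Fin n) => (e : Fin n → Fin n)) →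
      F j * (selectMatrix j).det = 0 := by
    intro j hj
    have : ¬ Function.Injective j := fun h =>
      hj ⟨Equiv.ofBijective j (Finite.injective_iff_bijective.1 h), rfl⟩
    obtain ⟨a, b, hab, hne⟩ := by simpa [Function.Injective] using this
    rw [det_zero_of_row_eq hne (by funext l; simp [selectMatrix, hab]), mul_zero]
  rw [← Finset.sum_subset (Finset.subset_univ
    (Finset.univ.map ⟨fun e : Perm (Fin n) => (e : Fin n → Fin n), DFunLike.coe_injective⟩))
    (fun r _ hr => hzero r (by simpa using hr)), Finset.sum_map]
  refine Finset.sum_congr rfl fun e _ => ?_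
  simp only [Function.Embedding.coeFn_mk]
  congr 1
  have : selectMatrix (e : Fin n → Fin n) = (1 : Matrix (Fin n) (Fin n) ℂ).submatrix e id := by
    ext i l
    simp [selectMatrix, one_apply]
  rw [this, det_permute, det_one, mul_one]

/-- The value on the real frame of a wedge product of coordinate `(1,1)`-forms. -/
theorem frameValue_prod_dz_dzbar (j k : Fin n → Fin n) :
    frameValue n (List.ofFn fun i =>
      ExteriorAlgebra.ι ℂ (dz (j i)) * ExteriorAlgebra.ι ℂ (dzbar (k i))).prod =
      (-2 * I) ^ n * ((selectMatrix j).det * (selectMatrix k).det) := by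
  set α : Fin (n * 2) → Covector n := fun p =>
    if (finProdFinEquiv.symm p).2 = 0 then dz (j (finProdFinEquiv.symm p).1)
    else dzbar (k (finProdFinEquiv.symm p).1) with hα
  have hprod : (List.ofFn fun i =>
      ExteriorAlgebra.ι ℂ (dz (j i)) * ExteriorAlgebra.ι ℂ (dzbar (k i))).prod =
      ExteriorAlgebra.ιMulti ℂ (n * 2) α := by
    rw [ExteriorAlgebra.ιMulti_apply, List.ofFn_mul, List.prod_flatten, List.map_ofFn]
    congr 2
    funext i
    have h : ∀ s : Fin 2, (⟨i * 2 + s, by omega⟩ : Fin (n * 2)) = finProdFinEquiv (i, s) := by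
      intro s
      ext
      simp [finProdFinEquiv]
      ring
    simp only [Function.comp_apply, h, hα, Equiv.symm_apply_apply]
    simp [List.ofFn_succ]
  rw [hprod, frameValue_wedge, ← det_submatrix_equiv_self finProdFinEquiv]
  set E : Matrix (Fin 2) (Fin 2) ℂ := !![1, I; 1, -I] with hE
  have hmat : (Matrix.of fun p q => α p (realBasis n q)).submatrix finProdFinEquiv
      finProdFinEquiv = blockDiagonal (fun s : Fin 2 => if s = 0 then selectMatrix j
        else selectMatrix k) * kroneckerMap (· * ·) (1 : Matrix (Fin n) (Fin n) ℂ) E := by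
    ext ⟨i, s⟩ ⟨l, t⟩
    rw [mul_apply, Fintype.sum_prod_type]
    simp only [submatrix_apply, of_apply, hα, realBasis, Equiv.symm_apply_apply,
      blockDiagonal_apply, kroneckerMap_apply, one_apply]
    fin_cases s <;> fin_cases t <;>
    simp [hE, selectMatrix, dz, dzbar, Pi.single_apply, apply_ite]
    exact fun h h' => absurd h h'
  rw [hmat, det_mul, det_blockDiagonal, det_kronecker, det_one, hE, det_fin_two_of]
  simp
  ring

/-- The value on the real frame of a wedge product of `(1,1)`-forms is a mixed discriminant of the
coefficient matrices. -/
theorem frameValue_prod_form11 (A : Fin n → Matrix (Fin n) (Fin n) ℂ) :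
    frameValue n (List.ofFn fun i => form11 (A i)).prod =
      2 ^ n * altSum (fun σ τ => ∏ i, A i (σ i) (τ i)) := by
  have h1 : (List.ofFn fun i => form11 (A i)).prod =
      ∑ r : Fin n → Fin n × Fin n, (∏ i, (I * A i (r i).1 (r i).2)) • (List.ofFn fun i =>
        ExteriorAlgebra.ι ℂ (dz (r i).1) * ExteriorAlgebra.ι ℂ (dzbar (r i).2)).prod := by
    have h2 : ∀ i, form11 (A i) = ∑ q : Fin n × Fin n, (I * A i q.1 q.2) •
        (ExteriorAlgebra.ι ℂ (dz q.1) * ExteriorAlgebra.ι ℂ (dzbar q.2)) := by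
      intro i
      rw [form11, Fintype.sum_prod_type]
    simp only [h2]
    rw [← MultilinearMap.mkPiAlgebraFin_apply (R := ℂ), MultilinearMap.map_sum]
    refine Finset.sum_congr rfl fun r _ => ?_
    rw [MultilinearMap.map_smul_univ, MultilinearMap.mkPiAlgebraFin_apply]
  rw [h1, map_sum]
  simp only [map_smul, smul_eq_mul, frameValue_prod_dz_dzbar, Finset.prod_mul_distrib,
    Finset.prod_const, Finset.card_univ, Fintype.card_fin]
  have h3 : ∀ r : Fin n → Fin n × Fin n, I ^ n * (∏ i, A i (r i).1 (r i).2) *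
      ((-2 * I) ^ n * ((selectMatrix fun i => (r i).1).det * (selectMatrix fun i => (r i).2).det)) =
      2 ^ n * ((∏ i, A i (r i).1 (r i).2) *
        ((selectMatrix fun i => (r i).1).det * (selectMatrix fun i => (r i).2).det)) := by
    intro r
    have : I ^ n * (-2 * I) ^ n = 2 ^ n := by
      rw [← mul_pow, show I * (-2 * I) = -2 * (I * I) by ring, I_mul_I]
      norm_num
    linear_combination ((∏ i, A i (r i).1 (r i).2) *
        ((selectMatrix fun i => (r i).1).det * (selectMatrix fun i => (r i).2).det)) * this
  simp only [h3]
  rw [← Finset.mul_sum]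
  congr 1
  refine (Fintype.sum_equiv
    (Equiv.arrowProdEquivProdArrow (Fin n) (fun _ => Fin n) (fun _ => Fin n)) _
    (fun q => (∏ i, A i (q.1 i) (q.2 i)) * ((selectMatrix q.1).det * (selectMatrix q.2).det))
    (fun r => rfl)).trans ?_
  rw [Fintype.sum_prod_type]
  have h4 : ∀ j : Fin n → Fin n, ∑ k : Fin n → Fin n,
      (∏ i, A i (j i) (k i)) * ((selectMatrix j).det * (selectMatrix k).det) =
      (∑ τ : Perm (Fin n), (∏ i, A i (j i) (τ i)) * ((Perm.sign τ : ℤ) : ℂ)) *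
        (selectMatrix j).det := by
    intro j
    rw [← sum_mul_det_selectMatrix (fun k => ∏ i, A i (j i) (k i)), Finset.sum_mul]
    exact Finset.sum_congr rfl fun k _ => by ring
  simp only [h4]
  rw [sum_mul_det_selectMatrix (fun j => ∑ τ : Perm (Fin n),
    (∏ i, A i (j i) (τ i)) * ((Perm.sign τ : ℤ) : ℂ)), altSum]
  refine Finset.sum_congr rfl fun σ _ => ?_
  rw [Finset.sum_mul]
  exact Finset.sum_congr rfl fun τ _ => by ring

/-- A mixed discriminant depends only on the number of slots taken by each matrix. -/
theorem mixedDisc_congr_card {S T : Finset (Fin n)} (h : S.card = T.card)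
    (A g : Matrix (Fin n) (Fin n) ℂ) : mixedDisc S A g = mixedDisc T A g := by
  obtain ⟨e⟩ : Nonempty (S ≃ T) := ⟨Finset.equivOfCardEq h⟩
  set π : Perm (Fin n) := e.extendSubtype with hπ
  have hST : S.map π.toEmbedding = T := by
    refine Finset.eq_of_subset_of_card_le ?_ (by simp [h])
    intro a ha
    obtain ⟨b, hb, rfl⟩ := Finset.mem_map.1 ha
    exact Equiv.extendSubtype_mem e b hb
  have hππ : ∀ a, π⁻¹ (π a) = a := π.symm_apply_apply
  have hST' : (S.map π.toEmbedding)ᶜ = Sᶜ.map π.toEmbedding := by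
    ext a
    simp
  have hsign : ((Perm.sign π : ℤ) : ℂ) * ((Perm.sign π : ℤ) : ℂ) = 1 := by
    rcases Int.units_eq_one_or (Perm.sign π) with h1 | h1 <;> simp [h1]
  unfold mixedDisc altSum
  symm
  rw [← Fintype.sum_equiv (Equiv.mulRight π⁻¹) _ _ (fun σ => rfl)]
  refine Finset.sum_congr rfl fun σ _ => ?_
  rw [← Fintype.sum_equiv (Equiv.mulRight π⁻¹) _ _ (fun σ => rfl)]
  refine Finset.sum_congr rfl fun τ _ => ?_
  simp only [← hST, hST', Finset.prod_map, Equiv.coe_mulRight, Perm.sign_mul,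
    Perm.sign_inv, Units.val_mul, Int.cast_mul,
    Perm.mul_apply, Equiv.coe_toEmbedding, hππ]
  linear_combination (((Perm.sign σ : ℤ) : ℂ) * ((Perm.sign τ : ℤ) : ℂ) *
    ((∏ i ∈ S, A (σ i) (τ i)) * ∏ i ∈ Sᶜ, g (σ i) (τ i))) * hsign

/-- The forms `A ^ k ∧ g ^ (n - k)` are mixed discriminants, so that the pointwise conditions of
subharmonicity say that the coefficient matrix lies in the cone. -/
theorem density_pow_mul_pow {S : Finset (Fin n)} {k : ℕ} (hS : S.card = k)
    (A g : Matrix (Fin n) (Fin n) ℂ) :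
    density (form11 A ^ k * form11 g ^ (n - k)) = 2 ^ n * (mixedDisc S A g).re := by
  have hk : k ≤ n := by simpa [hS] using S.card_le_univ
  obtain ⟨d, rfl⟩ := Nat.exists_eq_add_of_le hk
  set T : Finset (Fin (k + d)) := Finset.univ.filter fun i => (i : ℕ) < k with hT
  have hTc : T.card = k := by
    rw [hT, Fin.card_filter_val_lt]
    omega
  rw [mixedDisc_congr_card (hS.trans hTc.symm)]
  have h1 : form11 A ^ k * form11 g ^ d =
      (List.ofFn fun i : Fin (k + d) => form11 (if (i : ℕ) < k then A else g)).prod := by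
    rw [List.ofFn_add, List.prod_append]
    congr 1
    · simp
    · simp
  rw [Nat.add_sub_cancel_left, h1, density, frameValue_prod_form11]
  have h2 : altSum (fun σ τ => ∏ i : Fin (k + d), (if (i : ℕ) < k then A else g) (σ i) (τ i)) =
      mixedDisc T A g := by
    refine altSum_congr fun σ τ => ?_
    rw [← Finset.prod_mul_prod_compl T]
    congr 1
    · exact Finset.prod_congr rfl fun i hi => by simp [(Finset.mem_filter.1 hi).2]
    · exact Finset.prod_congr rfl fun i hi => by
        have : ¬ (i : ℕ) < k := by simpa [hT] using hi
        simp [this]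
  rw [h2, ← Complex.ofReal_ofNat, ← Complex.ofReal_pow, Complex.re_ofReal_mul]

/-! ### Polarization -/

/-- The polarization identity in a commutative ring. -/
theorem factorial_mul_prod_eq_sum {R : Type*} [CommRing R] {k : ℕ} (a : Fin k → R) :
    (k.factorial : R) * ∏ i, a i =
      ∑ T : Finset (Fin k), (-1) ^ Tᶜ.card * (∑ i ∈ T, a i) ^ k := by
  have h1 : ∀ T : Finset (Fin k), (∑ i ∈ T, a i) ^ k =
      ∑ p : Fin k → Fin k, (∏ l, a (p l)) * ∏ l, if p l ∈ T then 1 else 0 := by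
    intro T
    have : ∑ i ∈ T, a i = ∑ i, a i * if i ∈ T then 1 else 0 := by simp
    rw [this]
    rw [show ∀ x : R, x ^ k = ∏ _l : Fin k, x by simp, Finset.prod_univ_sum, Fintype.piFinset_univ]
    exact Finset.sum_congr rfl fun p _ => Finset.prod_mul_distrib
  have h2 : ∀ p : Fin k → Fin k,
      ∑ T : Finset (Fin k), (-1 : R) ^ Tᶜ.card * ∏ l, (if p l ∈ T then 1 else 0) =
        if Function.Bijective p then 1 else 0 := by
    intro p
    have h3 : ∀ T : Finset (Fin k), (-1 : R) ^ Tᶜ.card * ∏ l, (if p l ∈ T then 1 else 0) =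
        (∏ i ∈ T, 1) * ∏ i ∈ Finset.univ \ T, if i ∈ Set.range p then 0 else -1 := by
      intro T
      rw [Finset.prod_const_one, one_mul, ← Finset.compl_eq_univ_sdiff]
      by_cases h : ∀ l, p l ∈ T
      · rw [Finset.prod_congr rfl (fun l _ => if_pos (h l)), Finset.prod_const_one, mul_one,
          ← Finset.prod_const]
        refine Finset.prod_congr rfl fun i hi => (if_neg ?_).symm
        rintro ⟨l, rfl⟩
        exact Finset.mem_compl.1 hi (h l)
      · push Not at h
        obtain ⟨l, hl⟩ := h
        have hz : ∏ l, (if p l ∈ T then (1 : R) else 0) = 0 :=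
          Finset.prod_eq_zero (Finset.mem_univ l) (if_neg hl)
        have hz' : ∏ i ∈ Tᶜ, (if i ∈ Set.range p then (0 : R) else -1) = 0 :=
          Finset.prod_eq_zero (Finset.mem_compl.2 hl) (if_pos ⟨l, rfl⟩)
        rw [hz, hz', mul_zero]
    simp only [h3]
    rw [← Finset.powerset_univ, ← Finset.prod_add]
    have hb : Function.Surjective p ↔ Function.Bijective p := Finite.surjective_iff_bijective
    by_cases hp : Function.Surjective p
    · rw [if_pos (hb.1 hp)]
      refine Finset.prod_eq_one fun i _ => ?_
      rw [if_pos (Set.mem_range.2 (hp i)), add_zero]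
    · rw [if_neg fun h => hp h.2]
      obtain ⟨i, hi⟩ := not_forall.1 hp
      refine Finset.prod_eq_zero (Finset.mem_univ i) ?_
      rw [if_neg (fun h => hi (Set.mem_range.1 h)), add_neg_cancel]
  simp only [h1, Finset.mul_sum]
  rw [Finset.sum_comm]
  have h4 : ∀ p : Fin k → Fin k, ∑ T : Finset (Fin k),
      (-1 : R) ^ Tᶜ.card * ((∏ l, a (p l)) * ∏ l, (if p l ∈ T then 1 else 0)) =
      if Function.Bijective p then ∏ l, a l else 0 := by
    intro p
    have : ∀ T : Finset (Fin k), (-1 : R) ^ Tᶜ.card *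
        ((∏ l, a (p l)) * ∏ l, (if p l ∈ T then 1 else 0)) =
        (∏ l, a (p l)) * ((-1 : R) ^ Tᶜ.card * ∏ l, (if p l ∈ T then 1 else 0)) :=
      fun T => by ring
    simp only [this]
    rw [← Finset.mul_sum, h2]
    split_ifs with hp
    · rw [mul_one]
      exact Equiv.prod_comp (Equiv.ofBijective p hp) a
    · rw [mul_zero]
  simp only [h4]
  rw [← Finset.sum_filter, Finset.sum_const, nsmul_eq_mul]
  congr 2
  rw [← Fintype.card_subtype]
  have e : {p : Fin k → Fin k // Function.Bijective p} ≃ Perm (Fin k) :=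
    { toFun := fun p => Equiv.ofBijective p.1 p.2
      invFun := fun σ => ⟨σ, σ.bijective⟩
      left_inv := fun p => rfl
      right_inv := fun σ => by ext; rfl }
  rw [Fintype.card_congr e, Fintype.card_perm, Fintype.card_fin]

open scoped IsMulCommutative in
/-- The polarization identity for `(1,1)`-forms. -/
theorem factorial_smul_prod_form11 {k : ℕ} (A : Fin k → Matrix (Fin n) (Fin n) ℂ) :
    (k.factorial : ℂ) • (List.ofFn fun j => form11 (A j)).prod =
      ∑ T : Finset (Fin k), ((-1 : ℂ) ^ Tᶜ.card) • form11 (∑ j ∈ T, A j) ^ k := by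
  -- The forms `form11 (A j)` generate a commutative algebra.
  let 𝒜 := Algebra.adjoin ℂ (Set.range (form11 : Matrix (Fin n) (Fin n) ℂ → Form n))
  have hcomm : ∀ a ∈ Set.range (form11 : Matrix (Fin n) (Fin n) ℂ → Form n),
      ∀ b ∈ Set.range (form11 : Matrix (Fin n) (Fin n) ℂ → Form n), a * b = b * a := by
    rintro _ ⟨B, rfl⟩ _ ⟨C, rfl⟩
    exact commute_form11 B C
  have : IsMulCommutative 𝒜 := Algebra.isMulCommutative_adjoin ℂ hcomm
  let a : Fin k → 𝒜 := fun j => ⟨form11 (A j), Algebra.subset_adjoin ⟨A j, rfl⟩⟩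
  have h := congrArg 𝒜.val (factorial_mul_prod_eq_sum a)
  rw [← List.prod_ofFn] at h
  simp only [map_mul, map_natCast, map_sum, map_pow, map_neg, map_one, map_list_prod,
    List.map_ofFn] at h
  rw [Nat.cast_smul_eq_nsmul, nsmul_eq_mul]
  refine h.trans (Finset.sum_congr rfl fun T _ => ?_)
  rw [form11_sum, Algebra.smul_def, map_pow, map_neg, map_one]
  rfl

theorem factorial_mul_density_prod {k : ℕ} (A : Fin k → Matrix (Fin n) (Fin n) ℂ)
    (η : Form n) :
    (k.factorial : ℝ) * density ((List.ofFn fun j => form11 (A j)).prod * η) =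
      ∑ T : Finset (Fin k), (-1 : ℝ) ^ Tᶜ.card * density (form11 (∑ j ∈ T, A j) ^ k * η) := by
  have h := congrArg (fun ξ => (frameValue n (ξ * η)).re) (factorial_smul_prod_form11 A)
  simp only [Finset.sum_mul, smul_mul_assoc, map_sum, map_smul, smul_eq_mul, Complex.re_sum] at h
  have h1 : ∀ (j : ℕ) (w : ℂ), ((-1 : ℂ) ^ j * w).re = (-1 : ℝ) ^ j * w.re := by
    intro j w
    rw [show (-1 : ℂ) ^ j = (((-1 : ℝ) ^ j : ℝ) : ℂ) by push_cast; rfl, Complex.re_ofReal_mul]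
  simp only [h1] at h
  rw [← Complex.ofReal_natCast, Complex.re_ofReal_mul] at h
  exact h

end Forms

/-! ### Wirtinger derivatives -/

section Wirtinger

variable {n : ℕ}

/-- The first-order operator `(∂/∂x_j + c ∂/∂y_j) / 2`, which is `∂/∂z_j` for `c = -i` and
`∂/∂z̄_j` for `c = i`. -/
def wirtinger (c : ℂ) (j : Fin n) (f : (Fin n → ℂ) → ℂ) (z : Fin n → ℂ) : ℂ :=
  (fderiv ℝ f z (Pi.single j 1) + c * fderiv ℝ f z (Pi.single j I)) / 2

theorem del_eq_wirtinger (j : Fin n) : del j = wirtinger (-I) j := by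
  funext f z
  simp only [del, wirtinger]
  ring

theorem delbar_eq_wirtinger (j : Fin n) : delbar j = wirtinger I j := rfl

theorem _root_.ContDiff.wirtinger {f : (Fin n → ℂ) → ℂ} {k m : WithTop ℕ∞} (hf : ContDiff ℝ m f)
    (hk : k + 1 ≤ m) (c : ℂ) (j : Fin n) : ContDiff ℝ k (CLN.wirtinger c j f) := by
  unfold CLN.wirtinger
  have h := hf.fderiv_right hk
  fun_prop

theorem wirtinger_congr {f g : (Fin n → ℂ) → ℂ} {z : Fin n → ℂ} (h : f =ᶠ[nhds z] g) (c : ℂ)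
    (j : Fin n) : wirtinger c j f =ᶠ[nhds z] wirtinger c j g := by
  filter_upwards [h.fderiv (𝕜 := ℝ)] with w hw
  simp only [wirtinger, hw]

theorem wirtinger_mul {f g : (Fin n → ℂ) → ℂ} {z : Fin n → ℂ} (hf : DifferentiableAt ℝ f z)
    (hg : DifferentiableAt ℝ g z) (c : ℂ) (j : Fin n) :
    wirtinger c j (fun w => f w * g w) z =
      wirtinger c j f z * g z + f z * wirtinger c j g z := by
  simp only [wirtinger, fderiv_fun_mul hf hg, add_apply, smul_apply, smul_eq_mul]
  ring

theorem wirtinger_prod {ι : Type*} [DecidableEq ι] (T : Finset ι) {f : ι → (Fin n → ℂ) → ℂ}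
    {z : Fin n → ℂ} (hf : ∀ i, DifferentiableAt ℝ (f i) z) (c : ℂ) (j : Fin n) :
    wirtinger c j (fun w => ∏ i ∈ T, f i w) z =
      ∑ l ∈ T, wirtinger c j (f l) z * ∏ i ∈ T.erase l, f i z := by
  induction T using Finset.induction with
  | empty => simp [wirtinger]
  | insert a T ha ih =>
    have hd : DifferentiableAt ℝ (fun w => ∏ i ∈ T, f i w) z := by
      exact (HasFDerivAt.finsetProd fun i _ => (hf i).hasFDerivAt).differentiableAt
    simp only [Finset.prod_insert ha]
    rw [wirtinger_mul (hf a) hd, ih, Finset.sum_insert ha, Finset.erase_insert ha,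
      Finset.mul_sum]
    congr 1
    refine Finset.sum_congr rfl fun l hl => ?_
    have hla : a ≠ l := fun h => ha (h ▸ hl)
    rw [Finset.erase_insert_of_ne hla, Finset.prod_insert (fun h => ha (Finset.mem_of_mem_erase h))]
    ring

theorem wirtinger_comm {f : (Fin n → ℂ) → ℂ} (hf : ContDiff ℝ 2 f) (c d : ℂ) (j k : Fin n)
    (z : Fin n → ℂ) :
    wirtinger c j (wirtinger d k f) z = wirtinger d k (wirtinger c j f) z := by
  have hd : Differentiable ℝ (fderiv ℝ f) :=
    (hf.fderiv_right (m := 1) (by norm_num)).differentiable (by norm_num)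
  have h1 : ∀ (d : ℂ) (k : Fin n) (v : Fin n → ℂ), fderiv ℝ (wirtinger d k f) z v =
      (fderiv ℝ (fderiv ℝ f) z v (Pi.single k 1) +
        d * fderiv ℝ (fderiv ℝ f) z v (Pi.single k I)) / 2 := by
    intro d k v
    have h2 : ∀ e : Fin n → ℂ, HasFDerivAt (fun w => fderiv ℝ f w e)
        ((fderiv ℝ (fderiv ℝ f) z).flip e) z := fun e =>
      ((hd z).hasFDerivAt.clm_apply (hasFDerivAt_const e z)).congr_fderiv (by ext; simp)
    have h3 : HasFDerivAt (wirtinger d k f) ((2⁻¹ : ℂ) •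
        ((fderiv ℝ (fderiv ℝ f) z).flip (Pi.single k 1) +
          d • (fderiv ℝ (fderiv ℝ f) z).flip (Pi.single k I))) z := by
      have := ((h2 (Pi.single k 1)).add ((h2 (Pi.single k I)).const_mul d)).const_mul (2⁻¹ : ℂ)
      refine this.congr_of_eventuallyEq (Filter.Eventually.of_forall fun w => ?_)
      simp only [wirtinger, Pi.add_apply]
      ring
    rw [h3.fderiv]
    simp
    ring
  have hsymm : IsSymmSndFDerivAt ℝ f z :=
    hf.contDiffAt.isSymmSndFDerivAt (by simp)
  have e1 := hsymm (Pi.single j 1) (Pi.single k 1)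
  have e2 := hsymm (Pi.single j 1) (Pi.single k I)
  have e3 := hsymm (Pi.single j I) (Pi.single k 1)
  have e4 := hsymm (Pi.single j I) (Pi.single k I)
  rw [wirtinger, wirtinger]
  simp only [h1]
  rw [e1, e2, e3, e4]
  ring

theorem star_wirtinger (c : ℂ) (j : Fin n) {u : (Fin n → ℂ) → ℂ}
    (hu : Differentiable ℝ u) (z : Fin n → ℂ) :
    star (wirtinger c j u z) = wirtinger (star c) j (fun w => star (u w)) z := by
  have h : fderiv ℝ (fun w => star (u w)) z =
      (Complex.conjCLE : ℂ →L[ℝ] ℂ).comp (fderiv ℝ u z) :=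
    (Complex.conjCLE.hasFDerivAt.comp z (hu z).hasFDerivAt).fderiv
  simp only [wirtinger, h]
  simp

theorem tsupport_wirtinger_subset (c : ℂ) (j : Fin n) (f : (Fin n → ℂ) → ℂ) :
    tsupport (wirtinger c j f) ⊆ tsupport f := by
  refine closure_minimal (fun z hz => ?_) (isClosed_tsupport f)
  by_contra h
  have h1 := fun v => congrArg (fun L : (Fin n → ℂ) →L[ℝ] ℂ => L v)
    (image_eq_zero_of_notMem_tsupport (fun h' => h (tsupport_fderiv_subset ℝ h')) : fderiv ℝ f z = 0)
  exact hz (by simp [wirtinger, h1])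

theorem _root_.HasCompactSupport.wirtinger {f : (Fin n → ℂ) → ℂ} (hf : HasCompactSupport f) (c : ℂ)
    (j : Fin n) : HasCompactSupport (CLN.wirtinger c j f) :=
  hf.of_isClosed_subset (isClosed_tsupport _) (tsupport_wirtinger_subset c j f)

/-- Integration by parts. -/
theorem integral_wirtinger_mul {f g : (Fin n → ℂ) → ℂ} (hf : ContDiff ℝ 1 f)
    (hg : ContDiff ℝ 1 g) (hgc : HasCompactSupport g) (c : ℂ) (j : Fin n) :
    ∫ z, wirtinger c j f z * g z = -∫ z, f z * wirtinger c j g z := by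
  have hf' := (hf.fderiv_right (m := 0) (by norm_num)).continuous
  have hg' := (hg.fderiv_right (m := 0) (by norm_num)).continuous
  have hfc := hf.continuous
  have hgcont := hg.continuous
  have hgc' : ∀ v : Fin n → ℂ, HasCompactSupport fun z => fderiv ℝ g z v := fun v =>
    hgc.fderiv_apply ℝ v
  have i1 : ∀ v : Fin n → ℂ, Integrable fun z => fderiv ℝ f z v * g z := fun v =>
    Continuous.integrable_of_hasCompactSupport (by fun_prop) hgc.mul_left
  have i2 : ∀ v : Fin n → ℂ, Integrable fun z => f z * fderiv ℝ g z v := fun v =>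
    Continuous.integrable_of_hasCompactSupport (by fun_prop) (hgc' v).mul_left
  have key : ∀ v : Fin n → ℂ, ∫ z, f z * fderiv ℝ g z v = -∫ z, fderiv ℝ f z v * g z := fun v =>
    integral_mul_fderiv_eq_neg_fderiv_mul_of_integrable (i1 v) (i2 v)
      (Continuous.integrable_of_hasCompactSupport (by fun_prop) hgc.mul_left)
      (fun z _ => hf.differentiable (by norm_num) z)
      (fun z _ => hg.differentiable (by norm_num) z)
  have e1 : ∀ z, wirtinger c j f z * g z = 2⁻¹ * (fderiv ℝ f z (Pi.single j 1) * g z) +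
      (2⁻¹ * c) * (fderiv ℝ f z (Pi.single j I) * g z) := fun z => by
    simp only [wirtinger]; ring
  have e2 : ∀ z, f z * wirtinger c j g z = 2⁻¹ * (f z * fderiv ℝ g z (Pi.single j 1)) +
      (2⁻¹ * c) * (f z * fderiv ℝ g z (Pi.single j I)) := fun z => by
    simp only [wirtinger]; ring
  simp only [e1, e2]
  rw [integral_add ((i1 _).const_mul _) ((i1 _).const_mul _),
    integral_add ((i2 _).const_mul _) ((i2 _).const_mul _), integral_const_mul,
    integral_const_mul, integral_const_mul, integral_const_mul, key, key]
  ring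

/-- The complex Hessian of a complex-valued function. -/
def hess (v : (Fin n → ℂ) → ℂ) (a b : Fin n) : (Fin n → ℂ) → ℂ :=
  wirtinger (-I) a (wirtinger I b v)

theorem complexHessian_apply (u : (Fin n → ℂ) → ℝ) (z : Fin n → ℂ) (a b : Fin n) :
    complexHessian u z a b = hess (fun w => (u w : ℂ)) a b z := by
  simp only [complexHessian, Matrix.of_apply, hess, del_eq_wirtinger, delbar_eq_wirtinger]

theorem continuous_hess {v : (Fin n → ℂ) → ℂ} (hv : ContDiff ℝ 2 v) (a b : Fin n) :
    Continuous (hess v a b) :=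
  ((hv.wirtinger (k := 1) (by norm_num) I b).wirtinger (k := 0) (by norm_num) (-I) a).continuous

theorem contDiff_hess {v : (Fin n → ℂ) → ℂ} (hv : ContDiff ℝ ∞ v) (a b : Fin n) :
    ContDiff ℝ ∞ (hess v a b) :=
  (hv.wirtinger (k := ∞) (by simp) I b).wirtinger (k := ∞) (by simp) (-I) a

theorem _root_.HasCompactSupport.hess {v : (Fin n → ℂ) → ℂ} (hv : HasCompactSupport v) (a b : Fin n) :
    HasCompactSupport (CLN.hess v a b) := (hv.wirtinger I b).wirtinger (-I) a

theorem hess_congr {f g : (Fin n → ℂ) → ℂ} {z : Fin n → ℂ} (h : f =ᶠ[nhds z] g) (a b : Fin n) :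
    hess f a b z = hess g a b z :=
  (wirtinger_congr (wirtinger_congr h I b) (-I) a).self_of_nhds

end Wirtinger

/-! ### Approximation by smooth functions -/

section Smoothing

variable {n : ℕ}

open scoped Convolution

theorem wirtinger_convolution {ρ : (Fin n → ℂ) → ℝ} (hρ : LocallyIntegrable ρ)
    {f : (Fin n → ℂ) → ℂ} (hf : ContDiff ℝ 1 f) (hfc : HasCompactSupport f) (c : ℂ) (j : Fin n) :
    wirtinger c j (ρ ⋆[ContinuousLinearMap.lsmul ℝ ℝ] f) =
      (ρ ⋆[ContinuousLinearMap.lsmul ℝ ℝ] wirtinger c j f) := by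
  funext z
  have hf' := (hf.fderiv_right (m := 0) (by norm_num)).continuous
  have h1 : ∀ v : Fin n → ℂ, fderiv ℝ (ρ ⋆[ContinuousLinearMap.lsmul ℝ ℝ] f) z v =
      (ρ ⋆[ContinuousLinearMap.lsmul ℝ ℝ] fun w => fderiv ℝ f w v) z := by
    intro v
    rw [(hfc.hasFDerivAt_convolution_right (ContinuousLinearMap.lsmul ℝ ℝ) hρ hf z).fderiv]
    exact convolution_precompR_apply _ hρ (hfc.fderiv ℝ) hf' z v
  have hint : ∀ v : Fin n → ℂ,
      Integrable fun t => ρ t • fderiv ℝ f (z - t) v := by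
    intro v
    exact (hfc.fderiv_apply ℝ v).convolutionExists_right (ContinuousLinearMap.lsmul ℝ ℝ) hρ
      (by fun_prop) z
  rw [wirtinger, h1, h1]
  simp only [convolution_def, ContinuousLinearMap.lsmul_apply]
  rw [← integral_const_mul, ← integral_add (hint _) ((hint _).const_mul c), ← integral_div]
  refine integral_congr_ae (Filter.Eventually.of_forall fun t => ?_)
  simp only [wirtinger, Complex.real_smul]
  ring

/-- Compactly supported functions of class `C²` are approximated by smooth functions, uniformly
together with the complex Hessian. -/
theorem exists_smooth_approx {v : (Fin n → ℂ) → ℂ} (hv : ContDiff ℝ 2 v)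
    (hvc : HasCompactSupport v) {ε : ℝ} (hε : 0 < ε) :
    ∃ w : (Fin n → ℂ) → ℂ, ContDiff ℝ ∞ w ∧ (∀ z, ‖w z - v z‖ ≤ ε) ∧
      ∀ a b z, ‖hess w a b z - hess v a b z‖ ≤ ε := by
  have huc : ∀ f : (Fin n → ℂ) → ℂ, Continuous f → HasCompactSupport f →
      ∃ δ > 0, ∀ x y, dist x y < δ → dist (f x) (f y) ≤ ε := by
    intro f hf hfc
    obtain ⟨δ, hδ, h⟩ := Metric.uniformContinuous_iff.1
      (hfc.uniformContinuous_of_continuous hf) ε hε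
    exact ⟨δ, hδ, fun x y hxy => (h hxy).le⟩
  obtain ⟨δ0, hδ0, h0⟩ := huc v hv.continuous hvc
  choose δ hδ hh using fun a b => huc (hess v a b) (continuous_hess hv a b) (hvc.hess a b)
  obtain ⟨r, hr, hr0, hrab⟩ : ∃ r > 0, r ≤ δ0 ∧ ∀ a b, r ≤ δ a b := by
    refine ⟨(insert δ0 (Finset.univ.image fun q : Fin n × Fin n => δ q.1 q.2)).min'
      (Finset.insert_nonempty _ _), ?_, ?_, ?_⟩
    · refine (Finset.lt_min'_iff _ _).2 fun y hy => ?_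
      rcases Finset.mem_insert.1 hy with rfl | hy
      · exact hδ0
      · obtain ⟨q, -, rfl⟩ := Finset.mem_image.1 hy
        exact hδ _ _
    · exact Finset.min'_le _ _ (Finset.mem_insert_self _ _)
    · intro a b
      exact Finset.min'_le _ _ (Finset.mem_insert_of_mem
        (Finset.mem_image.2 ⟨(a, b), Finset.mem_univ _, rfl⟩))
  let φ : ContDiffBump (0 : Fin n → ℂ) := ⟨r / 2, r, by positivity, by linarith⟩
  have hφ : LocallyIntegrable (φ.normed volume) := φ.continuous_normed.locallyIntegrable
  refine ⟨φ.normed volume ⋆[ContinuousLinearMap.lsmul ℝ ℝ] v, ?_, fun z => ?_, fun a b z => ?_⟩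
  · exact φ.hasCompactSupport_normed.contDiff_convolution_left _ φ.contDiff_normed
      hv.continuous.locallyIntegrable
  · rw [← dist_eq_norm]
    refine φ.dist_normed_convolution_le hv.continuous.aestronglyMeasurable fun x hx => ?_
    exact h0 _ _ ((Metric.mem_ball.1 hx).trans_le hr0)
  · have h1 : hess (φ.normed volume ⋆[ContinuousLinearMap.lsmul ℝ ℝ] v) a b =
        (φ.normed volume ⋆[ContinuousLinearMap.lsmul ℝ ℝ] hess v a b) := by
      rw [hess, wirtinger_convolution hφ (hv.of_le (by norm_num)) hvc,
        wirtinger_convolution hφ (hv.wirtinger (by norm_num) I b) (hvc.wirtinger I b)]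
      rfl
    rw [h1, ← dist_eq_norm]
    refine φ.dist_normed_convolution_le (continuous_hess hv a b).aestronglyMeasurable
      fun x hx => ?_
    exact hh a b _ _ ((Metric.mem_ball.1 hx).trans_le (hrab a b))

end Smoothing

/-! ### Integration by parts for mixed discriminants -/

section Parts

open Equiv

variable {n : ℕ}

theorem integral_altSum {Φ : Perm (Fin n) → Perm (Fin n) → (Fin n → ℂ) → ℂ}
    (h : ∀ σ τ, Integrable (Φ σ τ)) :
    ∫ z, altSum (fun σ τ => Φ σ τ z) = altSum fun σ τ => ∫ z, Φ σ τ z := by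
  unfold altSum
  rw [integral_finsetSum _ fun σ _ => integrable_finsetSum _ fun τ _ => (h σ τ).const_mul _]
  refine Finset.sum_congr rfl fun σ _ => ?_
  rw [integral_finsetSum _ fun τ _ => (h σ τ).const_mul _]
  exact Finset.sum_congr rfl fun τ _ => integral_const_mul _ _

theorem integrable_altSum {Φ : Perm (Fin n) → Perm (Fin n) → (Fin n → ℂ) → ℂ}
    (h : ∀ σ τ, Integrable (Φ σ τ)) : Integrable fun z => altSum fun σ τ => Φ σ τ z := by
  unfold altSum
  exact integrable_finsetSum _ fun σ _ => integrable_finsetSum _ fun τ _ => (h σ τ).const_mul _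

/-- In an alternating sum, a derivative in the direction of the slot `i₀` only falls on the factor
that does not carry a closed form: the terms in which it falls on `h (σ l) (τ l)` are symmetric in
the slots `i₀` and `l`. -/
theorem altSum_wirtinger_left {c : ℂ} {h : Fin n → Fin n → (Fin n → ℂ) → ℂ}
    {Φ : Perm (Fin n) → Perm (Fin n) → (Fin n → ℂ) → ℂ} {a : Perm (Fin n) → ℂ}
    {i₀ : Fin n} {T : Finset (Fin n)} (hi : i₀ ∉ T) {z : Fin n → ℂ}
    (hh : ∀ p q, DifferentiableAt ℝ (h p q) z) (hΦ : ∀ σ τ, DifferentiableAt ℝ (Φ σ τ) z)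
    (hclosed : ∀ p p' q, wirtinger c p (h p' q) z = wirtinger c p' (h p q) z)
    (hinv : ∀ l ∈ T, ∀ σ τ, Φ (σ * swap i₀ l) τ = Φ σ τ) :
    altSum (fun σ τ => a τ *
        wirtinger c (σ i₀) (fun w => (∏ i ∈ T, h (σ i) (τ i) w) * Φ σ τ w) z) =
      altSum fun σ τ => a τ *
        ((∏ i ∈ T, h (σ i) (τ i) z) * wirtinger c (σ i₀) (Φ σ τ) z) := by
  have hexp : ∀ σ τ : Perm (Fin n),
      a τ * wirtinger c (σ i₀) (fun w => (∏ i ∈ T, h (σ i) (τ i) w) * Φ σ τ w) z =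
      (∑ l ∈ T, a τ * (wirtinger c (σ i₀) (h (σ l) (τ l)) z *
        (∏ i ∈ T.erase l, h (σ i) (τ i) z) * Φ σ τ z)) +
      a τ * ((∏ i ∈ T, h (σ i) (τ i) z) * wirtinger c (σ i₀) (Φ σ τ) z) := by
    intro σ τ
    have hd : DifferentiableAt ℝ (fun w => ∏ i ∈ T, h (σ i) (τ i) w) z := by
      exact (HasFDerivAt.finsetProd fun i _ => (hh _ _).hasFDerivAt).differentiableAt
    rw [wirtinger_mul hd (hΦ σ τ), wirtinger_prod T (fun i => hh (σ i) (τ i)), mul_add,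
      Finset.sum_mul, Finset.mul_sum]
  rw [altSum_congr hexp, altSum_add, altSum_sum, Finset.sum_eq_zero, zero_add]
  intro l hl
  have hne : i₀ ≠ l := fun h => hi (h ▸ hl)
  refine altSum_eq_zero_left hne fun σ τ => ?_
  rw [hinv l hl]
  simp only [Perm.mul_apply, swap_apply_left, swap_apply_right]
  rw [hclosed]
  congr 3
  refine Finset.prod_congr rfl fun i hi' => ?_
  have hne' : i ≠ i₀ := by
    rintro rfl
    exact hi (Finset.mem_of_mem_erase hi')
  rw [swap_apply_of_ne_of_ne hne' (Finset.ne_of_mem_erase hi')]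

theorem altSum_wirtinger_right {c : ℂ} {h : Fin n → Fin n → (Fin n → ℂ) → ℂ}
    {Φ : Perm (Fin n) → Perm (Fin n) → (Fin n → ℂ) → ℂ} {a : Perm (Fin n) → ℂ}
    {i₀ : Fin n} {T : Finset (Fin n)} (hi : i₀ ∉ T) {z : Fin n → ℂ}
    (hh : ∀ p q, DifferentiableAt ℝ (h p q) z) (hΦ : ∀ σ τ, DifferentiableAt ℝ (Φ σ τ) z)
    (hclosed : ∀ p q q', wirtinger c q (h p q') z = wirtinger c q' (h p q) z)
    (hinv : ∀ l ∈ T, ∀ σ τ, Φ σ (τ * swap i₀ l) = Φ σ τ) :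
    altSum (fun σ τ => a σ *
        wirtinger c (τ i₀) (fun w => (∏ i ∈ T, h (σ i) (τ i) w) * Φ σ τ w) z) =
      altSum fun σ τ => a σ *
        ((∏ i ∈ T, h (σ i) (τ i) z) * wirtinger c (τ i₀) (Φ σ τ) z) := by
  rw [← altSum_comm, ← altSum_comm fun σ τ => a σ * _]
  exact altSum_wirtinger_left (h := fun p q => h q p) (Φ := fun σ τ => Φ τ σ) hi
    (fun p q => hh q p) (fun σ τ => hΦ τ σ) (fun p p' q => hclosed q p p')
    (fun l hl σ τ => hinv l hl τ σ)

theorem integral_altSum_hess_smooth {v : (Fin n → ℂ) → ℂ} (hv : ContDiff ℝ ∞ v)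
    {Φ : Perm (Fin n) → Perm (Fin n) → (Fin n → ℂ) → ℂ} (hΦ : ∀ σ τ, ContDiff ℝ ∞ (Φ σ τ))
    (hΦc : ∀ σ τ, HasCompactSupport (Φ σ τ)) {i₀ : Fin n} {T : Finset (Fin n)} (hi : i₀ ∉ T)
    (hl : ∀ l ∈ T, ∀ σ τ, Φ (σ * swap i₀ l) τ = Φ σ τ)
    (hr : ∀ l ∈ T, ∀ σ τ, Φ σ (τ * swap i₀ l) = Φ σ τ) :
    ∫ z, altSum (fun σ τ => (∏ i ∈ insert i₀ T, hess v (σ i) (τ i) z) * Φ σ τ z) =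
      ∫ z, altSum (fun σ τ => v z * ((∏ i ∈ T, hess v (σ i) (τ i) z) *
        wirtinger I (τ i₀) (wirtinger (-I) (σ i₀) (Φ σ τ)) z)) := by
  have hprod : ∀ σ τ : Perm (Fin n), ContDiff ℝ ∞ fun w => ∏ i ∈ T, hess v (σ i) (τ i) w :=
    fun σ τ => contDiff_prod fun i _ => contDiff_hess hv _ _
  have hdb : ∀ j, ContDiff ℝ ∞ (wirtinger I j v) := fun j => hv.wirtinger (by simp) I j
  have hdΦ : ∀ σ τ j, ContDiff ℝ ∞ (wirtinger (-I) j (Φ σ τ)) := fun σ τ j =>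
    (hΦ σ τ).wirtinger (by simp) (-I) j
  have one_le : (1 : WithTop ℕ∞) ≤ ((⊤ : ℕ∞) : WithTop ℕ∞) := by norm_cast
  have two_le : (2 : WithTop ℕ∞) ≤ ((⊤ : ℕ∞) : WithTop ℕ∞) := by norm_cast
  have hF : ∀ σ τ : Perm (Fin n),
      ContDiff ℝ ∞ fun w => (∏ i ∈ T, hess v (σ i) (τ i) w) * Φ σ τ w := fun σ τ =>
    (hprod σ τ).mul (hΦ σ τ)
  have hG : ∀ σ τ : Perm (Fin n), ContDiff ℝ ∞ fun w =>
      (∏ i ∈ T, hess v (σ i) (τ i) w) * wirtinger (-I) (σ i₀) (Φ σ τ) w := fun σ τ =>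
    (hprod σ τ).mul (hdΦ σ τ _)
  have hFc : ∀ σ τ : Perm (Fin n), HasCompactSupport fun w =>
      (∏ i ∈ T, hess v (σ i) (τ i) w) * Φ σ τ w := fun σ τ => (hΦc σ τ).mul_left
  have hGc : ∀ σ τ : Perm (Fin n), HasCompactSupport fun w =>
      (∏ i ∈ T, hess v (σ i) (τ i) w) * wirtinger (-I) (σ i₀) (Φ σ τ) w := fun σ τ =>
    ((hΦc σ τ).wirtinger _ _).mul_left
  have hint : ∀ {f g : (Fin n → ℂ) → ℂ}, ContDiff ℝ ∞ f → ContDiff ℝ ∞ g →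
      HasCompactSupport g → Integrable fun z => f z * g z := fun hf hg hgc =>
    Continuous.integrable_of_hasCompactSupport (hf.continuous.mul hg.continuous) hgc.mul_left
  have hclosed1 : ∀ p p' q z, wirtinger (-I) p (hess v p' q) z = wirtinger (-I) p' (hess v p q) z :=
    fun p p' q z => wirtinger_comm ((hdb q).of_le two_le) _ _ _ _ z
  have hclosed2 : ∀ p q q' z, wirtinger I q (hess v p q') z = wirtinger I q' (hess v p q) z := by
    intro p q q' z
    have e : ∀ q, hess v p q = wirtinger I q (wirtinger (-I) p v) := fun q =>
      funext fun w => wirtinger_comm (hv.of_le two_le) _ _ _ _ w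
    rw [e, e]
    exact wirtinger_comm ((hv.wirtinger (k := ∞) (by simp) (-I) p).of_le two_le) _ _ _ _ z
  calc ∫ z, altSum (fun σ τ => (∏ i ∈ insert i₀ T, hess v (σ i) (τ i) z) * Φ σ τ z)
      = altSum fun σ τ => ∫ z, wirtinger (-I) (σ i₀) (wirtinger I (τ i₀) v) z *
          ((∏ i ∈ T, hess v (σ i) (τ i) z) * Φ σ τ z) := by
        rw [← integral_altSum fun σ τ => hint ((hdb _).wirtinger (by simp) _ _) (hF σ τ) (hFc σ τ)]
        simp only [Finset.prod_insert hi, mul_assoc, hess]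
    _ = altSum fun σ τ => -∫ z, wirtinger I (τ i₀) v z * wirtinger (-I) (σ i₀)
          (fun w => (∏ i ∈ T, hess v (σ i) (τ i) w) * Φ σ τ w) z :=
        altSum_congr fun σ τ => integral_wirtinger_mul ((hdb _).of_le one_le)
          ((hF σ τ).of_le one_le) (hFc σ τ) _ _
    _ = -∫ z, altSum fun σ τ => wirtinger I (τ i₀) v z * wirtinger (-I) (σ i₀)
          (fun w => (∏ i ∈ T, hess v (σ i) (τ i) w) * Φ σ τ w) z := by
        rw [integral_altSum fun σ τ => hint (hdb _) ((hF σ τ).wirtinger (by simp) _ _)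
          ((hFc σ τ).wirtinger _ _)]
        simp [altSum]
    _ = -∫ z, altSum fun σ τ => wirtinger I (τ i₀) v z * ((∏ i ∈ T, hess v (σ i) (τ i) z) *
          wirtinger (-I) (σ i₀) (Φ σ τ) z) := by
        congr 2
        funext z
        exact altSum_wirtinger_left (a := fun τ => wirtinger I (τ i₀) v z) hi
          (fun p q => (contDiff_hess hv p q).differentiable (by simp) z)
          (fun σ τ => (hΦ σ τ).differentiable (by simp) z)
          (fun p p' q => hclosed1 p p' q z) hl
    _ = altSum fun σ τ => -∫ z, wirtinger I (τ i₀) v z * ((∏ i ∈ T, hess v (σ i) (τ i) z) *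
          wirtinger (-I) (σ i₀) (Φ σ τ) z) := by
        rw [integral_altSum fun σ τ => hint (hdb _) (hG σ τ) (hGc σ τ)]
        simp [altSum]
    _ = altSum fun σ τ => ∫ z, v z * wirtinger I (τ i₀) (fun w =>
          (∏ i ∈ T, hess v (σ i) (τ i) w) * wirtinger (-I) (σ i₀) (Φ σ τ) w) z :=
        altSum_congr fun σ τ => by
          rw [integral_wirtinger_mul (hv.of_le one_le) ((hG σ τ).of_le one_le) (hGc σ τ), neg_neg]
    _ = ∫ z, altSum fun σ τ => v z * wirtinger I (τ i₀) (fun w =>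
          (∏ i ∈ T, hess v (σ i) (τ i) w) * wirtinger (-I) (σ i₀) (Φ σ τ) w) z :=
        (integral_altSum fun σ τ => hint hv ((hG σ τ).wirtinger (by simp) _ _)
          ((hGc σ τ).wirtinger _ _)).symm
    _ = _ := by
        congr 1
        funext z
        refine altSum_wirtinger_right (a := fun _ => v z)
          (Φ := fun σ τ => wirtinger (-I) (σ i₀) (Φ σ τ)) hi
          (fun p q => (contDiff_hess hv p q).differentiable (by simp) z)
          (fun σ τ => (hdΦ σ τ _).differentiable (by simp) z)
          (fun p q q' => hclosed2 p q q' z) fun l hl' σ τ => ?_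
        rw [hr l hl']

theorem tendsto_integral_prod_mul {ι : Type*} (T : Finset ι) {y : ℕ → ι → (Fin n → ℂ) → ℂ}
    {y₀ : ι → (Fin n → ℂ) → ℂ} (hy : ∀ m i, Continuous (y m i))
    {M : ℝ} (hM : ∀ i z, ‖y₀ i z‖ ≤ M) (happ : ∀ m i z, ‖y m i z - y₀ i z‖ ≤ 1 / ((m : ℝ) + 1))
    {Φ : (Fin n → ℂ) → ℂ} (hΦ : Continuous Φ) (hΦc : HasCompactSupport Φ) :
    Filter.Tendsto (fun m => ∫ z, (∏ i ∈ T, y m i z) * Φ z) Filter.atTop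
      (nhds (∫ z, (∏ i ∈ T, y₀ i z) * Φ z)) := by
  refine tendsto_integral_of_dominated_convergence (fun z => (M + 1) ^ T.card * ‖Φ z‖) ?_ ?_ ?_ ?_
  · intro m
    have := hy m
    exact (by fun_prop : Continuous fun z => (∏ i ∈ T, y m i z) * Φ z).aestronglyMeasurable
  · exact ((hΦ.integrable_of_hasCompactSupport hΦc).norm).const_mul _
  · refine fun m => Filter.Eventually.of_forall fun z => ?_
    rw [norm_mul, norm_prod, ← Finset.prod_const]
    refine mul_le_mul_of_nonneg_right (Finset.prod_le_prod (fun _ _ => norm_nonneg _)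
      fun i _ => ?_) (norm_nonneg _)
    have h1 : 1 / ((m : ℝ) + 1) ≤ 1 := by
      rw [div_le_one (by positivity)]
      linarith [(Nat.cast_nonneg m : (0 : ℝ) ≤ m)]
    calc ‖y m i z‖ = ‖y₀ i z + (y m i z - y₀ i z)‖ := by congr 1; ring
      _ ≤ M + 1 := (norm_add_le _ _).trans (add_le_add (hM i z) ((happ m i z).trans h1))
  · refine Filter.Eventually.of_forall fun z => Filter.Tendsto.mul_const _ ?_
    refine tendsto_finsetProd _ fun i _ => ?_
    rw [tendsto_iff_norm_sub_tendsto_zero]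
    exact squeeze_zero (fun _ => norm_nonneg _) (fun m => happ m i z)
      tendsto_one_div_add_atTop_nhds_zero_nat

/-- Integration by parts for mixed discriminants of the complex Hessian of a function of class
`C²`: both derivatives of the Hessian in the slot `i₀` are moved to the test form `Φ`. -/
theorem integral_altSum_hess {v : (Fin n → ℂ) → ℂ} (hv : ContDiff ℝ 2 v)
    (hvc : HasCompactSupport v)
    {Φ : Perm (Fin n) → Perm (Fin n) → (Fin n → ℂ) → ℂ} (hΦ : ∀ σ τ, ContDiff ℝ ∞ (Φ σ τ))
    (hΦc : ∀ σ τ, HasCompactSupport (Φ σ τ)) {i₀ : Fin n} {T : Finset (Fin n)} (hi : i₀ ∉ T)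
    (hl : ∀ l ∈ T, ∀ σ τ, Φ (σ * swap i₀ l) τ = Φ σ τ)
    (hr : ∀ l ∈ T, ∀ σ τ, Φ σ (τ * swap i₀ l) = Φ σ τ) :
    ∫ z, altSum (fun σ τ => (∏ i ∈ insert i₀ T, hess v (σ i) (τ i) z) * Φ σ τ z) =
      ∫ z, altSum (fun σ τ => v z * ((∏ i ∈ T, hess v (σ i) (τ i) z) *
        wirtinger I (τ i₀) (wirtinger (-I) (σ i₀) (Φ σ τ)) z)) := by
  choose w hw hw0 hwh using fun m : ℕ => exists_smooth_approx hv hvc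
    (Nat.one_div_pos_of_nat (α := ℝ) (n := m))
  obtain ⟨M0, hM0⟩ := hvc.exists_bound_of_continuous hv.continuous
  choose M hM using fun a b => (hvc.hess a b).exists_bound_of_continuous (continuous_hess hv a b)
  have hwc : ∀ m a b, Continuous (hess (w m) a b) := fun m a b =>
    (contDiff_hess (hw m) a b).continuous
  have hvh : ∀ a b, Continuous (hess v a b) := continuous_hess hv
  set B : ℝ := |M0| + ∑ a, ∑ b, |M a b| with hB
  have hB0 : ∀ z, ‖v z‖ ≤ B := fun z => (hM0 z).trans ((le_abs_self _).trans
    (le_add_of_nonneg_right (by positivity)))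
  have hBh : ∀ a b z, ‖hess v a b z‖ ≤ B := fun a b z => by
    have h1 : |M a b| ≤ ∑ b, |M a b| :=
      Finset.single_le_sum (f := fun b => |M a b|) (fun _ _ => abs_nonneg _) (Finset.mem_univ b)
    have h2 : ∑ b, |M a b| ≤ ∑ a, ∑ b, |M a b| :=
      Finset.single_le_sum (f := fun a => ∑ b, |M a b|) (fun _ _ => by positivity)
        (Finset.mem_univ a)
    linarith [hM a b z, le_abs_self (M a b), abs_nonneg M0]
  set Θ : Perm (Fin n) → Perm (Fin n) → (Fin n → ℂ) → ℂ := fun σ τ =>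
    wirtinger I (τ i₀) (wirtinger (-I) (σ i₀) (Φ σ τ)) with hΘ
  have hΘ' : ∀ σ τ, Continuous (Θ σ τ) := fun σ τ =>
    (((hΦ σ τ).wirtinger (k := ∞) (by simp) _ _).wirtinger (k := ∞) (by simp) _ _).continuous
  have hΘc : ∀ σ τ, HasCompactSupport (Θ σ τ) := fun σ τ =>
    ((hΦc σ τ).wirtinger _ _).wirtinger _ _
  have hΦ' : ∀ σ τ, Continuous (Φ σ τ) := fun σ τ => (hΦ σ τ).continuous
  have L : ∀ f : (Fin n → ℂ) → ℂ, (∀ a b, Continuous (hess f a b)) →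
      ∫ z, altSum (fun σ τ => (∏ i ∈ insert i₀ T, hess f (σ i) (τ i) z) * Φ σ τ z) =
      altSum fun σ τ => ∫ z, (∏ i ∈ insert i₀ T, hess f (σ i) (τ i) z) * Φ σ τ z :=
    fun f hf => integral_altSum fun σ τ => Continuous.integrable_of_hasCompactSupport
      (by fun_prop) (hΦc σ τ).mul_left
  -- The factor in the slot `i₀` is the function itself.
  set y : ((Fin n → ℂ) → ℂ) → Perm (Fin n) → Perm (Fin n) → Fin n → (Fin n → ℂ) → ℂ :=
    fun f σ τ i => if i = i₀ then f else hess f (σ i) (τ i) with hy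
  have hyc : ∀ f : (Fin n → ℂ) → ℂ, Continuous f → (∀ a b, Continuous (hess f a b)) →
      ∀ σ τ i, Continuous (y f σ τ i) := by
    intro f hf hf' σ τ i
    simp only [hy]
    split_ifs
    · exact hf
    · exact hf' _ _
  have hyprod : ∀ f σ τ z, f z * ((∏ i ∈ T, hess f (σ i) (τ i) z) * Θ σ τ z) =
      (∏ i ∈ insert i₀ T, y f σ τ i z) * Θ σ τ z := by
    intro f σ τ z
    rw [Finset.prod_insert hi, mul_assoc]
    simp only [hy, if_true]
    congr 2
    refine Finset.prod_congr rfl fun i hiT => ?_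
    have hne' : i ≠ i₀ := by
      rintro rfl
      exact hi hiT
    rw [if_neg hne']
  have R : ∀ f : (Fin n → ℂ) → ℂ, Continuous f → (∀ a b, Continuous (hess f a b)) →
      ∫ z, altSum (fun σ τ => f z * ((∏ i ∈ T, hess f (σ i) (τ i) z) * Θ σ τ z)) =
      altSum fun σ τ => ∫ z, (∏ i ∈ insert i₀ T, y f σ τ i z) * Θ σ τ z := by
    intro f hf hf'
    simp only [hyprod]
    refine integral_altSum fun σ τ => ?_
    have := hyc f hf hf' σ τ
    exact Continuous.integrable_of_hasCompactSupport (by fun_prop) (hΘc σ τ).mul_left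
  have hlim : ∀ {F : ℕ → Perm (Fin n) → Perm (Fin n) → ℂ} {F₀ : Perm (Fin n) → Perm (Fin n) → ℂ},
      (∀ σ τ, Filter.Tendsto (fun m => F m σ τ) Filter.atTop (nhds (F₀ σ τ))) →
      Filter.Tendsto (fun m => altSum (F m)) Filter.atTop (nhds (altSum F₀)) := fun h =>
    tendsto_finsetSum _ fun σ _ => tendsto_finsetSum _ fun τ _ => (h σ τ).const_mul _
  have l1 : Filter.Tendsto (fun m => altSum fun σ τ =>
      ∫ z, (∏ i ∈ insert i₀ T, hess (w m) (σ i) (τ i) z) * Φ σ τ z) Filter.atTop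
      (nhds (altSum fun σ τ => ∫ z, (∏ i ∈ insert i₀ T, hess v (σ i) (τ i) z) * Φ σ τ z)) :=
    hlim fun σ τ => tendsto_integral_prod_mul (insert i₀ T)
      (y := fun m i => hess (w m) (σ i) (τ i)) (y₀ := fun i => hess v (σ i) (τ i))
      (fun m i => hwc m _ _) (fun i z => hBh _ _ z) (fun m i z => hwh m _ _ z) (hΦ' σ τ) (hΦc σ τ)
  have l2 : Filter.Tendsto (fun m => altSum fun σ τ =>
      ∫ z, (∏ i ∈ insert i₀ T, y (w m) σ τ i z) * Θ σ τ z) Filter.atTop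
      (nhds (altSum fun σ τ => ∫ z, (∏ i ∈ insert i₀ T, y v σ τ i z) * Θ σ τ z)) := by
    refine hlim fun σ τ => tendsto_integral_prod_mul (M := B) (insert i₀ T)
      (y := fun m i => y (w m) σ τ i) (y₀ := fun i => y v σ τ i)
      (fun m i => hyc _ (hw m).continuous (hwc m) σ τ i) (fun i z => ?_) (fun m i z => ?_)
      (hΘ' σ τ) (hΘc σ τ)
    · simp only [hy]
      split_ifs
      · exact hB0 z
      · exact hBh _ _ z
    · simp only [hy]
      split_ifs
      · exact hw0 m z
      · exact hwh m _ _ z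
  rw [L v hvh, R v hv.continuous hvh]
  refine tendsto_nhds_unique l1 (l2.congr fun m => ?_)
  rw [← L (w m) (hwc m), ← R (w m) (hw m).continuous (hwc m)]
  exact (integral_altSum_hess_smooth (hw m) hΦ hΦc hi hl hr).symm

end Parts

/-! ### The local estimate -/

section Estimate

open Equiv

variable {n : ℕ}

theorem exists_smooth_cutoff {K W : Set (Fin n → ℂ)} (hK : IsCompact K) (hW : IsOpen W)
    (hKW : K ⊆ W) :
    ∃ χ : (Fin n → ℂ) → ℝ, ContDiff ℝ ∞ χ ∧ HasCompactSupport χ ∧ tsupport χ ⊆ W ∧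
      (∀ z, 0 ≤ χ z ∧ χ z ≤ 1) ∧ ∀ z ∈ K, χ =ᶠ[nhds z] fun _ => 1 := by
  obtain ⟨V, hV, hKV, hVW, hVc⟩ := exists_open_between_and_isCompact_closure hK hW hKW
  obtain ⟨f, hf1, hf0, hf⟩ := exists_contMDiffMap_one_nhds_of_subset_interior
    (I := modelWithCornersSelf ℝ (Fin n → ℂ)) (n := (⊤ : ℕ∞)) hK.isClosed
    (show K ⊆ interior V by rwa [hV.interior_eq])
  have hts : tsupport f ⊆ closure V := closure_mono fun z hz => by
    by_contra h
    exact hz (hf0 z h)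
  refine ⟨f, contMDiff_iff_contDiff.1 f.contMDiff, hVc.of_isClosed_subset (isClosed_tsupport _) hts,
    hts.trans hVW, fun z => hf z, fun z hz => ?_⟩
  have := hf1.filter_mono (nhds_le_nhdsSet hz)
  exact this

theorem continuous_altSum {Φ : Perm (Fin n) → Perm (Fin n) → (Fin n → ℂ) → ℂ}
    (h : ∀ σ τ, Continuous (Φ σ τ)) : Continuous fun z => altSum fun σ τ => Φ σ τ z := by
  unfold altSum
  fun_prop

theorem HermitianMetric.continuous_coeff (g : HermitianMetric n) (j k : Fin n) :
    Continuous fun z => g.coeff z j k := (g.smooth j k).continuous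

theorem HermitianMetric.continuous_det (g : HermitianMetric n) :
    Continuous fun z => (g.coeff z).det := by
  simp only [Matrix.det_apply]
  have := g.continuous_coeff
  fun_prop

/-- The coefficient matrix of `ω + dd^c v`. -/
def twistMatrix (g : HermitianMetric n) (v : (Fin n → ℂ) → ℂ) (z : Fin n → ℂ) :
    Matrix (Fin n) (Fin n) ℂ :=
  Matrix.of fun a b => g.coeff z a b + 2 * hess v a b z

theorem continuous_mixedDisc {A B : (Fin n → ℂ) → Matrix (Fin n) (Fin n) ℂ}
    (hA : ∀ a b, Continuous fun z => A z a b) (hB : ∀ a b, Continuous fun z => B z a b)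
    (S : Finset (Fin n)) : Continuous fun z => (mixedDisc S (A z) (B z)).re := by
  unfold mixedDisc
  refine Complex.continuous_re.comp (continuous_altSum fun σ τ => ?_)
  fun_prop

theorem continuous_twistMatrix (g : HermitianMetric n) {v : (Fin n → ℂ) → ℂ}
    (hv : ContDiff ℝ 2 v) (a b : Fin n) : Continuous fun z => twistMatrix g v z a b := by
  have h1 := g.continuous_coeff a b
  have h2 := continuous_hess hv a b
  simp only [twistMatrix, Matrix.of_apply]
  fun_prop

/-- The coefficient bound for matrices in the cone, uniformly on a compact set. -/
theorem exists_norm_altSum_le (g : HermitianMetric n) {K : Set (Fin n → ℂ)} (hK : IsCompact K)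
    (R : Finset (Fin n)) {Ψ : Perm (Fin n) → Perm (Fin n) → (Fin n → ℂ) → ℂ}
    (hΨ : ∀ σ τ, Continuous (Ψ σ τ))
    (hinv : ∀ i ∈ R, ∀ j ∈ R, ∀ σ τ, Ψ (σ * swap i j) τ = Ψ σ τ) :
    ∃ c : ℝ, 0 ≤ c ∧ ∀ m, R.card < m → m ≤ n → ∀ z ∈ K, ∀ A, InCone (g.coeff z) m A →
      ‖altSum fun σ τ => (∏ i ∈ R, A (σ i) (τ i)) * Ψ σ τ z‖ ≤
        c * (mixedDisc R A (g.coeff z)).re := by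
  have hbdd : ∀ f : (Fin n → ℂ) → ℂ, Continuous f → ∃ C, ∀ z ∈ K, ‖f z‖ ≤ C := fun f hf =>
    hK.exists_bound_of_continuousOn hf.continuousOn
  choose B hB using fun σ τ => hbdd (Ψ σ τ) (hΨ σ τ)
  choose G hG using fun a => hbdd (fun z => g.coeff z a a) (g.continuous_coeff a a)
  obtain ⟨δ, hδ, hdet⟩ : ∃ δ > 0, ∀ z ∈ K, δ ≤ ‖(g.coeff z).det‖ := by
    rcases K.eq_empty_or_nonempty with rfl | hne
    · exact ⟨1, one_pos, by simp⟩
    · obtain ⟨z₀, -, hz₀⟩ := hK.exists_isMinOn hne g.continuous_det.norm.continuousOn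
      refine ⟨‖(g.coeff z₀).det‖, norm_pos_iff.2 (g.posDef z₀).det_pos.ne', fun z hz => hz₀ hz⟩
  set B' : ℝ := ∑ σ, ∑ τ, |B σ τ| with hB'
  set G' : ℝ := ∑ a, |G a| with hG'
  have hB1 : ∀ z ∈ K, ∀ σ τ, ‖Ψ σ τ z‖ ≤ B' := fun z hz σ τ =>
    calc ‖Ψ σ τ z‖ ≤ |B σ τ| := (hB σ τ z hz).trans (le_abs_self _)
      _ ≤ ∑ τ, |B σ τ| := Finset.single_le_sum (f := fun τ => |B σ τ|)
          (fun _ _ => abs_nonneg _) (Finset.mem_univ τ)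
      _ ≤ B' := Finset.single_le_sum (f := fun σ => ∑ τ, |B σ τ|)
          (fun _ _ => by positivity) (Finset.mem_univ σ)
  have hG1 : ∀ z ∈ K, ∀ a, ‖g.coeff z a a‖ ≤ G' := fun z hz a =>
    ((hG a z hz).trans (le_abs_self _)).trans
      (Finset.single_le_sum (f := fun a => |G a|) (fun _ _ => abs_nonneg _) (Finset.mem_univ a))
  refine ⟨((n : ℝ) ^ R.card * n ^ R.card * n.factorial ^ 2 * G' ^ R.card / δ) * B',
    by positivity, fun m hRm hm z hz A hA => ?_⟩
  exact hA.norm_altSum_le (g.posDef z) hm hRm (hG1 z hz) hδ (hdet z hz) (hB1 z hz)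
    fun i hi j hj σ τ => by rw [hinv i hi j hj]

theorem mixedDisc_empty (A g : Matrix (Fin n) (Fin n) ℂ) : mixedDisc ∅ A g = mixedDisc ∅ g g := by
  simp [mixedDisc]

/-- Expansion of one factor of `ω + dd^c v`. -/
theorem mixedDisc_twistMatrix (g : HermitianMetric n) (v : (Fin n → ℂ) → ℂ) (z : Fin n → ℂ)
    {S : Finset (Fin n)} {i₀ : Fin n} (hi : i₀ ∈ S) :
    mixedDisc S (twistMatrix g v z) (g.coeff z) =
      mixedDisc (S.erase i₀) (twistMatrix g v z) (g.coeff z) +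
        2 * ∑ T ∈ (S.erase i₀).powerset, 2 ^ T.card * altSum (fun σ τ =>
          (∏ i ∈ insert i₀ T, hess v (σ i) (τ i) z) *
            ∏ i ∈ (insert i₀ T)ᶜ, g.coeff z (σ i) (τ i)) := by
  simp only [Finset.mul_sum, ← altSum_mul_left]
  rw [← altSum_sum, mixedDisc, mixedDisc, ← altSum_add]
  refine altSum_congr fun σ τ => ?_
  have hc : (S.erase i₀)ᶜ = insert i₀ Sᶜ := by
    ext a
    simp only [Finset.mem_compl, Finset.mem_erase, Finset.mem_insert]
    tauto
  have hexp : ∏ i ∈ S.erase i₀, twistMatrix g v z (σ i) (τ i) =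
      ∑ T ∈ (S.erase i₀).powerset, 2 ^ T.card * ((∏ i ∈ T, hess v (σ i) (τ i) z) *
        ∏ i ∈ S.erase i₀ \ T, g.coeff z (σ i) (τ i)) := by
    simp only [twistMatrix, Matrix.of_apply, add_comm (g.coeff z _ _)]
    rw [Finset.prod_add]
    refine Finset.sum_congr rfl fun T _ => ?_
    rw [Finset.prod_mul_distrib, Finset.prod_const, mul_assoc]
  have hterm : ∀ T ∈ (S.erase i₀).powerset, 2 * (2 ^ T.card *
      ((∏ i ∈ insert i₀ T, hess v (σ i) (τ i) z) *
        ∏ i ∈ (insert i₀ T)ᶜ, g.coeff z (σ i) (τ i))) =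
      2 * hess v (σ i₀) (τ i₀) z * (2 ^ T.card * ((∏ i ∈ T, hess v (σ i) (τ i) z) *
        ∏ i ∈ S.erase i₀ \ T, g.coeff z (σ i) (τ i))) *
          ∏ i ∈ Sᶜ, g.coeff z (σ i) (τ i) := by
    intro T hT
    have hT' := Finset.mem_powerset.1 hT
    have hiT : i₀ ∉ T := fun h => Finset.notMem_erase i₀ S (hT' h)
    have hsplit : (insert i₀ T)ᶜ = (S.erase i₀ \ T) ∪ Sᶜ := by
      ext a
      have : a ∈ T → a ≠ i₀ ∧ a ∈ S := fun h => Finset.mem_erase.1 (hT' h)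
      have : a = i₀ → a ∈ S := fun h => h ▸ hi
      simp only [Finset.mem_compl, Finset.mem_insert, Finset.mem_union, Finset.mem_sdiff,
        Finset.mem_erase]
      tauto
    have hdisj : Disjoint (S.erase i₀ \ T) Sᶜ := by
      rw [Finset.disjoint_left]
      intro a ha ha'
      exact Finset.mem_compl.1 ha' (Finset.mem_of_mem_erase (Finset.mem_sdiff.1 ha).1)
    rw [Finset.prod_insert hiT, hsplit, Finset.prod_union hdisj]
    ring
  rw [Finset.sum_congr rfl hterm, ← Finset.sum_mul, ← Finset.mul_sum, ← hexp, hc,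
    Finset.prod_insert (by simpa using hi), ← Finset.mul_prod_erase S _ hi]
  conv_lhs => rw [twistMatrix, Matrix.of_apply]
  rw [← twistMatrix]
  ring

/-- Expansion of the powers of `dd^c v = (ω + dd^c v) - ω`. -/
theorem two_pow_mul_altSum_hess (g : HermitianMetric n) (v : (Fin n → ℂ) → ℂ) (z : Fin n → ℂ)
    (T : Finset (Fin n)) (Θ : Perm (Fin n) → Perm (Fin n) → ℂ) :
    2 ^ T.card * altSum (fun σ τ => v z * ((∏ i ∈ T, hess v (σ i) (τ i) z) * Θ σ τ)) =
      v z * ∑ R ∈ T.powerset, altSum (fun σ τ => (∏ i ∈ R, twistMatrix g v z (σ i) (τ i)) *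
        ((∏ i ∈ T \ R, -g.coeff z (σ i) (τ i)) * Θ σ τ)) := by
  rw [← altSum_sum, ← altSum_mul_left, ← altSum_mul_left]
  refine altSum_congr fun σ τ => ?_
  have hexp : 2 ^ T.card * ∏ i ∈ T, hess v (σ i) (τ i) z =
      ∑ R ∈ T.powerset, (∏ i ∈ R, twistMatrix g v z (σ i) (τ i)) *
        ∏ i ∈ T \ R, -g.coeff z (σ i) (τ i) := by
    rw [← Finset.prod_add, ← Finset.prod_const, ← Finset.prod_mul_distrib]
    refine Finset.prod_congr rfl fun i _ => ?_
    simp only [twistMatrix, Matrix.of_apply]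
    ring
  simp only [← mul_assoc, ← Finset.sum_mul]
  rw [← hexp]
  ring

/-- The Chern–Levine–Nirenberg estimate for one function, in terms of mixed discriminants. The
induction is on the set of slots taken by `ω + dd^c v`. The compact set varies in the induction,
while the neighbourhood `W` on which the function is bounded and subharmonic is fixed. -/
theorem exists_setIntegral_mixedDisc_le (g : HermitianMetric n) (S : Finset (Fin n))
    {K W : Set (Fin n → ℂ)} (hK : IsCompact K) (hW : IsOpen W) (hKW : K ⊆ W) :
    ∃ C : ℝ, 0 < C ∧ ∀ m, S.card ≤ m → m ≤ n → ∀ v : (Fin n → ℂ) → ℂ, ContDiff ℝ 2 v →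
      HasCompactSupport v → (∀ z ∈ W, InCone (g.coeff z) m (twistMatrix g v z)) →
      ∀ M : ℝ, 0 ≤ M → (∀ᵐ z ∂volume.restrict W, ‖v z‖ ≤ M) →
      ∫ z in K, (mixedDisc S (twistMatrix g v z) (g.coeff z)).re ≤ C * (1 + M) ^ S.card := by
  induction S using Finset.strongInduction generalizing K with
  | H S ih =>
  rcases S.eq_empty_or_nonempty with rfl | ⟨i₀, hi₀⟩
  · refine ⟨|∫ z in K, (mixedDisc ∅ (g.coeff z) (g.coeff z)).re| + 1, by positivity, ?_⟩
    intro m _ _ v _ _ _ M _ _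
    simp only [mixedDisc_empty (twistMatrix g v _), Finset.card_empty, pow_zero, mul_one]
    linarith [le_abs_self (∫ z in K, (mixedDisc ∅ (g.coeff z) (g.coeff z)).re)]
  obtain ⟨φ, hφ, hφc, hφW, hφ01, hφ1⟩ := exists_smooth_cutoff hK hW hKW
  set K' := tsupport φ with hK'
  have hK'c : IsCompact K' := hφc
  set S₀ := S.erase i₀ with hS₀
  have hS₀S : S₀ ⊂ S := Finset.erase_ssubset hi₀
  have hsub : ∀ R ⊆ S₀, R ⊂ S := fun R hR => hR.trans_ssubset hS₀S
  -- The test forms in the slots off `T` and their derivatives.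
  set Φ : Finset (Fin n) → Perm (Fin n) → Perm (Fin n) → (Fin n → ℂ) → ℂ := fun T σ τ z =>
    (φ z : ℂ) * ∏ i ∈ (insert i₀ T)ᶜ, g.coeff z (σ i) (τ i) with hΦdef
  have hφC : ContDiff ℝ ∞ fun z => (φ z : ℂ) := Complex.ofRealCLM.contDiff.comp hφ
  have hΦ : ∀ T σ τ, ContDiff ℝ ∞ (Φ T σ τ) := fun T σ τ =>
    hφC.mul (contDiff_prod fun i _ => g.smooth _ _)
  have hΦts : ∀ T σ τ, tsupport (Φ T σ τ) ⊆ K' := by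
    intro T σ τ
    refine closure_mono fun z hz => ?_
    rw [Function.mem_support] at hz ⊢
    intro h
    exact hz (by simp [hΦdef, h])
  have hΦc : ∀ T σ τ, HasCompactSupport (Φ T σ τ) := fun T σ τ =>
    hφc.of_isClosed_subset (isClosed_tsupport _) (hΦts T σ τ)
  have hΦinv : ∀ T : Finset (Fin n), ∀ i ∈ insert i₀ T, ∀ j ∈ insert i₀ T, ∀ σ τ,
      Φ T (σ * swap i j) τ = Φ T σ τ ∧ Φ T σ (τ * swap i j) = Φ T σ τ := by
    intro T i hi j hj σ τ
    have : ∀ k ∈ (insert i₀ T)ᶜ, swap i j k = k := fun k hk =>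
      swap_apply_of_ne_of_ne (fun h => Finset.mem_compl.1 hk (h ▸ hi))
        (fun h => Finset.mem_compl.1 hk (h ▸ hj))
    constructor
    all_goals
      funext z
      simp only [hΦdef]
      congr 1
      refine Finset.prod_congr rfl fun k hk => ?_
      rw [Perm.mul_apply, this k hk]
  set Θ : Finset (Fin n) → Perm (Fin n) → Perm (Fin n) → (Fin n → ℂ) → ℂ := fun T σ τ =>
    wirtinger I (τ i₀) (wirtinger (-I) (σ i₀) (Φ T σ τ)) with hΘdef
  have hΘ : ∀ T σ τ, Continuous (Θ T σ τ) := fun T σ τ =>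
    (((hΦ T σ τ).wirtinger (k := ∞) (by simp) _ _).wirtinger (k := ∞) (by simp) _ _).continuous
  have hΘ0 : ∀ T σ τ, ∀ z ∉ K', Θ T σ τ z = 0 := fun T σ τ z hz =>
    image_eq_zero_of_notMem_tsupport fun h => hz (hΦts T σ τ
      (tsupport_wirtinger_subset _ _ _ (tsupport_wirtinger_subset _ _ _ h)))
  -- The coefficient bound needs an order strictly below `m`, which holds for `R ⊆ S₀`.
  have hcoef : ∀ T R : Finset (Fin n), ∃ c : ℝ, 0 ≤ c ∧ (T ⊆ S₀ → R ⊆ T →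
      ∀ m, R.card < m → m ≤ n → ∀ z ∈ K', ∀ A, InCone (g.coeff z) m A →
      ‖altSum fun σ τ => (∏ i ∈ R, A (σ i) (τ i)) *
        ((∏ i ∈ T \ R, -g.coeff z (σ i) (τ i)) * Θ T σ τ z)‖ ≤
        c * (mixedDisc R A (g.coeff z)).re) := by
    intro T R
    by_cases hTR : T ⊆ S₀ ∧ R ⊆ T
    swap
    · exact ⟨0, le_rfl, fun h h' => absurd ⟨h, h'⟩ hTR⟩
    obtain ⟨hT, hR⟩ := hTR
    have hi₀T : i₀ ∉ T := fun h => Finset.notMem_erase i₀ S (hT h)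
    obtain ⟨c, hc, h⟩ := exists_norm_altSum_le g hK'c R
      (Ψ := fun σ τ z => (∏ i ∈ T \ R, -g.coeff z (σ i) (τ i)) * Θ T σ τ z)
      (fun σ τ => by
        have h1 := g.continuous_coeff
        have h2 := hΘ T σ τ
        fun_prop)
      (fun i hi j hj σ τ => by
        have hne : ∀ k ∈ R, i₀ ≠ k := fun k hk h => hi₀T (h ▸ hR hk)
        have h1 : Θ T (σ * swap i j) τ = Θ T σ τ := by
          simp only [hΘdef]
          rw [(hΦinv T i (Finset.mem_insert_of_mem (hR hi)) j
            (Finset.mem_insert_of_mem (hR hj)) σ τ).1, Perm.mul_apply,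
            swap_apply_of_ne_of_ne (hne i hi) (hne j hj)]
        funext z
        rw [h1]
        congr 1
        refine Finset.prod_congr rfl fun k hk => ?_
        have hkR := (Finset.mem_sdiff.1 hk).2
        have hki : k ≠ i := by
          rintro rfl
          exact hkR hi
        have hkj : k ≠ j := by
          rintro rfl
          exact hkR hj
        rw [Perm.mul_apply, swap_apply_of_ne_of_ne hki hkj])
    exact ⟨c, hc, fun _ _ => h⟩
  choose c hc hcoef using hcoef
  -- The induction hypothesis is applied on the support of the cut-off, which still lies in `W`.
  have hih : ∀ R : Finset (Fin n), ∃ C : ℝ, 0 < C ∧ (R ⊆ S₀ → ∀ m, R.card ≤ m → m ≤ n →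
      ∀ v : (Fin n → ℂ) → ℂ, ContDiff ℝ 2 v →
      HasCompactSupport v → (∀ z ∈ W, InCone (g.coeff z) m (twistMatrix g v z)) →
      ∀ M : ℝ, 0 ≤ M → (∀ᵐ z ∂volume.restrict W, ‖v z‖ ≤ M) →
      ∫ z in K', (mixedDisc R (twistMatrix g v z) (g.coeff z)).re ≤ C * (1 + M) ^ R.card) := by
    intro R
    by_cases hR : R ⊆ S₀
    · obtain ⟨C, hC, h⟩ := ih R (hsub R hR) hK'c hφW
      exact ⟨C, hC, fun _ => h⟩
    · exact ⟨1, one_pos, fun h => absurd h hR⟩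
  choose C hC hih using hih
  refine ⟨C S₀ + 2 * ∑ T ∈ S₀.powerset, ∑ R ∈ T.powerset, c T R * C R, ?_, ?_⟩
  · have : 0 ≤ ∑ T ∈ S₀.powerset, ∑ R ∈ T.powerset, c T R * C R :=
      Finset.sum_nonneg fun T _ => Finset.sum_nonneg fun R _ => mul_nonneg (hc T R) (hC R).le
    linarith [hC S₀]
  intro m hSm hmn v hv hvc hcone M hM hvM
  have hcard : S₀.card + 1 = S.card := Finset.card_erase_add_one hi₀
  have hgc := g.continuous_coeff
  have hAc := continuous_twistMatrix g hv
  set L : Finset (Fin n) → (Fin n → ℂ) → ℝ := fun R z =>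
    (mixedDisc R (twistMatrix g v z) (g.coeff z)).re with hL
  have hLc : ∀ R, Continuous (L R) := fun R => continuous_mixedDisc hAc hgc R
  have hL0 : ∀ R : Finset (Fin n), R.card ≤ m → ∀ z ∈ K', 0 ≤ L R z := fun R hR z hz =>
    (hcone z (hφW hz)).nonneg R hR
  have hφcont := hφ.continuous
  have hφ0 : ∀ z ∉ K', φ z = 0 := fun z hz => image_eq_zero_of_notMem_tsupport hz
  have hint : ∀ R, Integrable fun z => φ z * L R z := fun R =>
    Continuous.integrable_of_hasCompactSupport (hφcont.mul (hLc R)) hφc.mul_right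
  have hintK' : ∀ R, IntegrableOn (L R) K' := fun R =>
    (hLc R).continuousOn.integrableOn_compact hK'c
  -- The integrand is nonnegative on `W`, which allows the cut-off.
  have hcut : ∫ z in K, L S z ≤ ∫ z, φ z * L S z := by
    have h1 : ∫ z in K, L S z = ∫ z in K, φ z * L S z := by
      refine setIntegral_congr_fun hK.measurableSet fun z hz => ?_
      simp only [(hφ1 z hz).self_of_nhds, one_mul]
    rw [h1]
    refine setIntegral_le_integral (hint S) (Filter.Eventually.of_forall fun z => ?_)
    by_cases hz : z ∈ K'
    · exact mul_nonneg (hφ01 z).1 (hL0 S hSm z hz)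
    · simp [hφ0 z hz]
  have hlow : ∫ z, φ z * L S₀ z ≤ C S₀ * (1 + M) ^ S₀.card := by
    rw [← setIntegral_eq_integral_of_forall_compl_eq_zero (s := K')
      (fun z hz => by simp [hφ0 z hz])]
    refine le_trans (setIntegral_mono_on (hint S₀).integrableOn (hintK' S₀)
      hK'c.measurableSet fun z hz => ?_)
      (hih S₀ le_rfl m (by omega) hmn v hv hvc hcone M hM hvM)
    exact mul_le_of_le_one_left (hL0 S₀ (by omega) z hz) (hφ01 z).2
  set F : Finset (Fin n) → (Fin n → ℂ) → ℂ := fun T z =>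
    altSum fun σ τ => (∏ i ∈ insert i₀ T, hess v (σ i) (τ i) z) * Φ T σ τ z with hF
  have hFint : ∀ T, Integrable (F T) := fun T => integrable_altSum fun σ τ => by
    have h1 := continuous_hess hv
    have h2 := (hΦ T σ τ).continuous
    exact Continuous.integrable_of_hasCompactSupport (by fun_prop) (hΦc T σ τ).mul_left
  -- Both derivatives of one Hessian factor are moved to the test form. What remains is linear in
  -- `v`, bounded by `M`, and has at most `|S| - 1` factors `ω + dd^c v`.
  have hterm : ∀ T ⊆ S₀, ‖(2 : ℂ) ^ T.card * ∫ z, F T z‖ ≤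
      M * ∑ R ∈ T.powerset, c T R * (C R * (1 + M) ^ R.card) := by
    intro T hT
    have hi₀T : i₀ ∉ T := fun h => Finset.notMem_erase i₀ S (hT h)
    have hparts : ∫ z, F T z = ∫ z, altSum (fun σ τ => v z * ((∏ i ∈ T, hess v (σ i) (τ i) z) *
        Θ T σ τ z)) :=
      integral_altSum_hess hv hvc (hΦ T) (hΦc T) hi₀T
        (fun l hl σ τ => (hΦinv T i₀ (Finset.mem_insert_self _ _) l
          (Finset.mem_insert_of_mem hl) σ τ).1)
        (fun l hl σ τ => (hΦinv T i₀ (Finset.mem_insert_self _ _) l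
          (Finset.mem_insert_of_mem hl) σ τ).2)
    rw [hparts, ← integral_const_mul]
    simp only [two_pow_mul_altSum_hess g]
    rw [← setIntegral_eq_integral_of_forall_compl_eq_zero (s := K')
      (fun z hz => by simp [hΘ0 T _ _ z hz, altSum])]
    have hle : ∀ᵐ z ∂volume.restrict K',
        ‖v z * ∑ R ∈ T.powerset, altSum (fun σ τ =>
          (∏ i ∈ R, twistMatrix g v z (σ i) (τ i)) *
            ((∏ i ∈ T \ R, -g.coeff z (σ i) (τ i)) * Θ T σ τ z))‖ ≤
        M * ∑ R ∈ T.powerset, c T R * L R z := by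
      filter_upwards [ae_restrict_of_ae_restrict_of_subset hφW hvM,
        ae_restrict_mem hK'c.measurableSet] with z hz hzK
      rw [norm_mul]
      refine mul_le_mul hz ((norm_sum_le _ _).trans (Finset.sum_le_sum fun R hR => ?_))
        (norm_nonneg _) hM
      have hR' := Finset.mem_powerset.1 hR
      have h1 := Finset.card_le_card (hR'.trans hT)
      exact hcoef T R hT hR' m (by omega) hmn z hzK _ (hcone z (hφW hzK))
    refine (norm_integral_le_of_norm_le ?_ hle).trans ?_
    · exact (integrable_finsetSum _ fun R _ => (hintK' R).const_mul _).const_mul _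
    · rw [integral_const_mul, integral_finsetSum _ fun R _ => (hintK' R).const_mul _]
      refine mul_le_mul_of_nonneg_left (Finset.sum_le_sum fun R hR => ?_) hM
      have hR' := Finset.mem_powerset.1 hR
      have h1 := Finset.card_le_card (hR'.trans hT)
      rw [integral_const_mul]
      exact mul_le_mul_of_nonneg_left
        (hih R (hR'.trans hT) m (by omega) hmn v hv hvc hcone M hM hvM) (hc T R)
  -- One factor `ω + dd^c v` is split into `ω`, which leaves `L S₀`, and `dd^c v`.
  have hsplit : ∫ z, φ z * L S z = (∫ z, φ z * L S₀ z) +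
      2 * (∑ T ∈ S₀.powerset, (2 : ℂ) ^ T.card * ∫ z, F T z).re := by
    have hpt : ∀ z, φ z * L S z = φ z * L S₀ z +
        2 * (∑ T ∈ S₀.powerset, (2 : ℂ) ^ T.card * F T z).re := by
      intro z
      have h1 : ∀ T, F T z = φ z * altSum (fun σ τ =>
          (∏ i ∈ insert i₀ T, hess v (σ i) (τ i) z) *
            ∏ i ∈ (insert i₀ T)ᶜ, g.coeff z (σ i) (τ i)) := by
        intro T
        rw [hF, ← altSum_mul_left]
        exact altSum_congr fun σ τ => by simp only [hΦdef]; ring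
      have h2 : ∑ T ∈ S₀.powerset, (2 : ℂ) ^ T.card * F T z =
          φ z * ∑ T ∈ S₀.powerset, (2 : ℂ) ^ T.card * altSum (fun σ τ =>
          (∏ i ∈ insert i₀ T, hess v (σ i) (τ i) z) *
            ∏ i ∈ (insert i₀ T)ᶜ, g.coeff z (σ i) (τ i)) := by
        rw [Finset.mul_sum]
        exact Finset.sum_congr rfl fun T _ => by rw [h1]; ring
      simp only [hL]
      rw [h2, mixedDisc_twistMatrix g v z hi₀, Complex.add_re, Complex.re_ofReal_mul,
        ← Complex.ofReal_ofNat, Complex.re_ofReal_mul]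
      ring
    have hsumint : Integrable fun z => ∑ T ∈ S₀.powerset, (2 : ℂ) ^ T.card * F T z :=
      integrable_finsetSum _ fun T _ => (hFint T).const_mul _
    have hre : ∫ z, (∑ T ∈ S₀.powerset, (2 : ℂ) ^ T.card * F T z).re =
        (∑ T ∈ S₀.powerset, (2 : ℂ) ^ T.card * ∫ z, F T z).re := by
      have h1 : ∫ z, ∑ T ∈ S₀.powerset, (2 : ℂ) ^ T.card * F T z =
          ∑ T ∈ S₀.powerset, (2 : ℂ) ^ T.card * ∫ z, F T z := by
        rw [integral_finsetSum _ fun T _ => (hFint T).const_mul _]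
        exact Finset.sum_congr rfl fun T _ => integral_const_mul _ _
      rw [← h1]
      exact integral_re hsumint
    have hreint : Integrable fun z => (∑ T ∈ S₀.powerset, (2 : ℂ) ^ T.card * F T z).re :=
      hsumint.re
    simp only [hpt]
    rw [integral_add (hint S₀) (hreint.const_mul 2), integral_const_mul]
    exact congrArg (fun t => (∫ z, φ z * L S₀ z) + 2 * t) hre
  have hq : 1 ≤ 1 + M := by linarith
  have hcorr : (∑ T ∈ S₀.powerset, (2 : ℂ) ^ T.card * ∫ z, F T z).re ≤
      (∑ T ∈ S₀.powerset, ∑ R ∈ T.powerset, c T R * C R) * (1 + M) ^ S.card := by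
    refine (Complex.re_le_norm _).trans ((norm_sum_le _ _).trans ?_)
    rw [Finset.sum_mul]
    refine Finset.sum_le_sum fun T hT => (hterm T (Finset.mem_powerset.1 hT)).trans ?_
    rw [Finset.mul_sum, Finset.sum_mul]
    refine Finset.sum_le_sum fun R hR => ?_
    have hR' := (Finset.mem_powerset.1 hR).trans (Finset.mem_powerset.1 hT)
    have h1 := Finset.card_le_card hR'
    have h2 : M * (1 + M) ^ R.card ≤ (1 + M) ^ S.card :=
      calc M * (1 + M) ^ R.card ≤ (1 + M) * (1 + M) ^ R.card :=
            mul_le_mul_of_nonneg_right (by linarith) (by positivity)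
        _ = (1 + M) ^ (R.card + 1) := by ring
        _ ≤ (1 + M) ^ S.card := pow_le_pow_right₀ hq (by omega)
    calc M * (c T R * (C R * (1 + M) ^ R.card)) = c T R * C R * (M * (1 + M) ^ R.card) := by ring
      _ ≤ c T R * C R * (1 + M) ^ S.card :=
        mul_le_mul_of_nonneg_left h2 (mul_nonneg (hc T R) (hC R).le)
  have hpow : (1 + M) ^ S₀.card ≤ (1 + M) ^ S.card := pow_le_pow_right₀ hq (by omega)
  calc ∫ z in K, L S z ≤ ∫ z, φ z * L S z := hcut
    _ ≤ C S₀ * (1 + M) ^ S₀.card +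
        2 * ((∑ T ∈ S₀.powerset, ∑ R ∈ T.powerset, c T R * C R) * (1 + M) ^ S.card) := by
        rw [hsplit]
        linarith
    _ ≤ C S₀ * (1 + M) ^ S.card +
        2 * ((∑ T ∈ S₀.powerset, ∑ R ∈ T.powerset, c T R * C R) * (1 + M) ^ S.card) := by
        linarith [mul_le_mul_of_nonneg_left hpow (hC S₀).le]
    _ = _ := by ring

end Estimate

/-! ### Averages of cut-off functions -/

section Average

variable {n : ℕ}

theorem wirtinger_const_mul_sum {ι : Type*} (T : Finset ι) {w : ι → (Fin n → ℂ) → ℂ}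
    {z : Fin n → ℂ} (hw : ∀ j ∈ T, DifferentiableAt ℝ (w j) z) (s c : ℂ) (a : Fin n) :
    wirtinger c a (fun z => s * ∑ j ∈ T, w j z) z = s * ∑ j ∈ T, wirtinger c a (w j) z := by
  have h1 : fderiv ℝ (fun z => ∑ j ∈ T, w j z) z = ∑ j ∈ T, fderiv ℝ (w j) z :=
    fderiv_fun_sum hw
  have h2 : fderiv ℝ (fun z => s * ∑ j ∈ T, w j z) z = s • ∑ j ∈ T, fderiv ℝ (w j) z := by
    rw [← h1]
    exact fderiv_const_mul (DifferentiableAt.fun_sum hw) s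
  simp only [wirtinger, h2, smul_apply, sum_apply,
    smul_eq_mul, ← Finset.sum_div, Finset.sum_add_distrib, ← Finset.mul_sum]
  ring

theorem hess_const_mul_sum {ι : Type*} (T : Finset ι) {w : ι → (Fin n → ℂ) → ℂ}
    (hw : ∀ j ∈ T, ContDiff ℝ 2 (w j)) (s : ℂ) (a b : Fin n) (z : Fin n → ℂ) :
    hess (fun z => s * ∑ j ∈ T, w j z) a b z = s * ∑ j ∈ T, hess (w j) a b z := by
  have h : wirtinger I b (fun z => s * ∑ j ∈ T, w j z) =
      fun z => s * ∑ j ∈ T, wirtinger I b (w j) z := funext fun z =>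
    wirtinger_const_mul_sum T
      (fun j hj => ((hw j hj).differentiable (by norm_num)).differentiableAt) s I b
  rw [hess, h]
  exact wirtinger_const_mul_sum T (fun j hj => (((hw j hj).wirtinger (k := 1) (by norm_num)
    I b).differentiable (by norm_num)).differentiableAt) s (-I) a

/-- Averaging functions averages the forms `ω + dd^c w`, because the coefficients of the average
add up to one. -/
theorem card_smul_twistMatrix_average {ι : Type*} (g : HermitianMetric n) {T : Finset ι}
    (hT : T.Nonempty) {w : ι → (Fin n → ℂ) → ℂ} (hw : ∀ j ∈ T, ContDiff ℝ 2 (w j))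
    (z : Fin n → ℂ) :
    (T.card : ℂ) • twistMatrix g (fun z => (T.card : ℂ)⁻¹ * ∑ j ∈ T, w j z) z =
      ∑ j ∈ T, twistMatrix g (w j) z := by
  have hT0 : (T.card : ℂ) ≠ 0 := by exact_mod_cast hT.card_pos.ne'
  ext a b
  rw [Matrix.sum_apply]
  simp only [Matrix.smul_apply, twistMatrix, Matrix.of_apply, hess_const_mul_sum T hw,
    Finset.sum_add_distrib, Finset.sum_const, nsmul_eq_mul, ← Finset.mul_sum, smul_eq_mul]
  field_simp

theorem InCone.sum {ι : Type*} {T : Finset ι} (hT : T.Nonempty)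
    {A : ι → Matrix (Fin n) (Fin n) ℂ} {G : Matrix (Fin n) (Fin n) ℂ} (hG : G.PosDef) {m : ℕ}
    (hm : m ≤ n) (hA : ∀ j ∈ T, InCone G m (A j)) : InCone G m (∑ j ∈ T, A j) :=
  Finset.sum_induction_nonempty A (InCone G m) (fun _ _ => InCone.add hG hm) hT hA

theorem inCone_of_density_nonneg {A G : Matrix (Fin n) (Fin n) ℂ} (hG : G.PosDef)
    (hA : A.IsHermitian) {m : ℕ} (h : ∀ k, 1 ≤ k → k ≤ m →
      0 ≤ density (form11 A ^ k * form11 G ^ (n - k))) : InCone G m A := by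
  refine ⟨hA, fun S hS => ?_⟩
  rcases S.eq_empty_or_nonempty with rfl | hne
  · obtain ⟨P, l, -, rfl, rfl⟩ := exists_simultaneous_diag hG hA
    rw [mixedDisc_congr_diag, Complex.ofReal_re]
    simp only [Finset.prod_empty]
    positivity
  · have h1 := h S.card hne.card_pos hS
    rw [density_pow_mul_pow rfl] at h1
    exact nonneg_of_mul_nonneg_right h1 (by positivity)

/-- The form `ω + dd^c u` has the coefficient matrix `twistMatrix g u`. -/
theorem twist_eq_form11 (g : HermitianMetric n) (u : (Fin n → ℂ) → ℝ) (z : Fin n → ℂ) :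
    g.twist u z = form11 (twistMatrix g (fun w => (u w : ℂ)) z) := by
  rw [HermitianMetric.twist, HermitianMetric.form, ddc, ← form11_smul, ← form11_add]
  congr 1
  ext a b
  simp [twistMatrix, complexHessian_apply]

theorem isHermitian_twistMatrix (g : HermitianMetric n) {v : (Fin n → ℂ) → ℂ}
    (hv : ContDiff ℝ 2 v) (hreal : ∀ z, star (v z) = v z) (z : Fin n → ℂ) :
    (twistMatrix g v z).IsHermitian := by
  have hh : ∀ a b, star (hess v a b z) = hess v b a z := by
    intro a b
    have hv1 : ContDiff ℝ 1 (wirtinger I b v) := hv.wirtinger (by norm_num) I b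
    have h1 : (fun w => star (wirtinger I b v w)) = wirtinger (-I) b v := by
      funext w
      rw [star_wirtinger I b (hv.differentiable (by norm_num)) w]
      simp only [hreal]
      simp
    rw [hess, star_wirtinger _ _ (hv1.differentiable (by norm_num)), h1]
    have h2 : star (-I) = I := by simp
    rw [h2, wirtinger_comm hv, hess]
  ext a b
  have hg := (g.posDef z).1.apply a b
  simp only [twistMatrix, Matrix.conjTranspose_apply, Matrix.of_apply, star_add, star_mul', hh]
  rw [hg]
  simp

theorem contDiff_cutoff_mul {χ u : (Fin n → ℂ) → ℝ} {Ω : Set (Fin n → ℂ)} (hχ : ContDiff ℝ ∞ χ)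
    (hΩ : IsOpen Ω) (hts : tsupport χ ⊆ Ω) (hu : ContDiffOn ℝ 2 u Ω) :
    ContDiff ℝ 2 fun z => ((χ z * u z : ℝ) : ℂ) := by
  refine Complex.ofRealCLM.contDiff.comp (contDiff_iff_contDiffAt.2 fun z => ?_)
  by_cases hz : z ∈ Ω
  · exact (hχ.of_le (by norm_cast)).contDiffAt.mul
      (hu.contDiffAt (hΩ.mem_nhds hz))
  · have h0 : χ =ᶠ[nhds z] 0 := notMem_tsupport_iff_eventuallyEq.1 fun h => hz (hts h)
    refine (contDiffAt_const (c := (0 : ℝ))).congr_of_eventuallyEq ?_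
    filter_upwards [h0] with w hw
    change χ w * u w = 0
    rw [hw, Pi.zero_apply, zero_mul]

theorem supNorm_nonneg (U : Set (Fin n → ℂ)) (u : (Fin n → ℂ) → ℝ) : 0 ≤ supNorm U u :=
  ENNReal.toReal_nonneg

theorem ae_abs_le_supNorm {U Ω : Set (Fin n → ℂ)} {u : (Fin n → ℂ) → ℝ} (hU : IsOpen U)
    (hUc : IsCompact (closure U)) (hUΩ : closure U ⊆ Ω) (hu : ContinuousOn u Ω) :
    ∀ᵐ z ∂volume.restrict U, |u z| ≤ supNorm U u := by
  obtain ⟨B, hB⟩ := hUc.exists_bound_of_continuousOn (hu.mono hUΩ)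
  have hfin : eLpNorm u ⊤ (volume.restrict U) ≠ ⊤ := by
    rw [eLpNorm_exponent_top]
    refine (eLpNormEssSup_lt_top_of_ae_bound (C := B) ?_).ne
    filter_upwards [ae_restrict_mem hU.measurableSet] with z hz
    exact hB z (subset_closure hz)
  filter_upwards [ae_le_eLpNormEssSup (f := u) (μ := volume.restrict U)] with z hz
  rw [← eLpNorm_exponent_top] at hz
  have := ENNReal.toReal_mono hfin hz
  simpa [supNorm] using this

end Average

/-! ### Polarization of the estimate -/

section Polarization

variable {n : ℕ}

/-- The estimate for one function, applied to the average of the functions with index in `T`. -/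
theorem abs_setIntegral_density_sum_le (g : HermitianMetric n) {K W : Set (Fin n → ℂ)}
    (hK : IsCompact K) (hKW : K ⊆ W) {k m : ℕ} (hk : 1 ≤ k) (hkm : k ≤ m) (hm : m ≤ n)
    {S : Finset (Fin n)} (hS : S.card = k) {C : ℝ} (hC0 : 0 < C)
    (hC : ∀ v : (Fin n → ℂ) → ℂ, ContDiff ℝ 2 v → HasCompactSupport v →
      (∀ z ∈ W, InCone (g.coeff z) m (twistMatrix g v z)) →
      ∀ M : ℝ, 0 ≤ M → (∀ᵐ z ∂volume.restrict W, ‖v z‖ ≤ M) →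
      ∫ z in K, (mixedDisc S (twistMatrix g v z) (g.coeff z)).re ≤ C * (1 + M) ^ S.card)
    {w : Fin k → (Fin n → ℂ) → ℂ} (hw : ∀ j, ContDiff ℝ 2 (w j))
    (hwc : ∀ j, HasCompactSupport (w j))
    (hcone : ∀ j, ∀ z ∈ W, InCone (g.coeff z) m (twistMatrix g (w j) z))
    {M : Fin k → ℝ} (hM0 : ∀ j, 0 ≤ M j) (hM : ∀ j, ∀ᵐ z ∂volume.restrict W, ‖w j z‖ ≤ M j)
    (T : Finset (Fin k)) :
    |∫ z in K, density (form11 (∑ j ∈ T, twistMatrix g (w j) z) ^ k * g.form z ^ (n - k))| ≤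
      2 ^ n * (n + 1) ^ n * C * (1 + ∑ j, M j) ^ k := by
  have hMs : 0 ≤ ∑ j, M j := Finset.sum_nonneg fun j _ => hM0 j
  simp only [HermitianMetric.form, density_pow_mul_pow hS]
  rw [integral_const_mul]
  rcases T.eq_empty_or_nonempty with rfl | hT
  · have h0 : ∀ z, mixedDisc S 0 (g.coeff z) = 0 := fun z => by
      have h := mixedDisc_smul S 0 0 (g.coeff z)
      rwa [zero_smul, zero_pow (by omega), zero_mul] at h
    simp only [Finset.sum_empty, h0]
    simp only [Complex.zero_re, integral_zero, mul_zero, abs_zero]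
    positivity
  have hT0 : (T.card : ℂ) ≠ 0 := by exact_mod_cast hT.card_pos.ne'
  have hTR : (0 : ℝ) < T.card := by exact_mod_cast hT.card_pos
  set v : (Fin n → ℂ) → ℂ := fun z => (T.card : ℂ)⁻¹ * ∑ j ∈ T, w j z with hv
  have hsum : ∀ z, ∑ j ∈ T, twistMatrix g (w j) z = (T.card : ℂ) • twistMatrix g v z :=
    fun z => (card_smul_twistMatrix_average g hT (fun j _ => hw j) z).symm
  have hvC : ContDiff ℝ 2 v := contDiff_const.mul (ContDiff.sum fun j _ => hw j)
  have hvc : HasCompactSupport v := by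
    have h1 : IsCompact (⋃ j, tsupport (w j)) := isCompact_iUnion fun j => hwc j
    refine HasCompactSupport.intro h1 fun z hz => ?_
    have h2 : ∀ j, w j z = 0 := fun j => image_eq_zero_of_notMem_tsupport fun h =>
      hz (Set.mem_iUnion.2 ⟨j, h⟩)
    simp [hv, h2]
  have hvcone : ∀ z ∈ W, InCone (g.coeff z) m (twistMatrix g v z) := by
    intro z hz
    have h1 := (InCone.sum hT (g.posDef z) hm fun j _ => hcone j z hz).smul
      (c := (T.card : ℝ)⁻¹) (by positivity)
    rw [hsum, smul_smul] at h1
    push_cast at h1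
    rwa [inv_mul_cancel₀ hT0, one_smul] at h1
  have hvM : ∀ᵐ z ∂volume.restrict W, ‖v z‖ ≤ ∑ j, M j := by
    filter_upwards [ae_all_iff.2 hM] with z hz
    have h1 : ‖∑ j ∈ T, w j z‖ ≤ ∑ j, M j :=
      (norm_sum_le _ _).trans ((Finset.sum_le_sum fun j _ => hz j).trans
        (Finset.sum_le_sum_of_subset_of_nonneg (Finset.subset_univ T) fun j _ _ => hM0 j))
    have h2 : ((T.card : ℝ))⁻¹ ≤ 1 := inv_le_one_of_one_le₀ (by exact_mod_cast hT.card_pos)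
    calc ‖v z‖ = (T.card : ℝ)⁻¹ * ‖∑ j ∈ T, w j z‖ := by simp [hv]
      _ ≤ 1 * ‖∑ j ∈ T, w j z‖ := mul_le_mul_of_nonneg_right h2 (norm_nonneg _)
      _ ≤ ∑ j, M j := by rwa [one_mul]
  have hle := hC v hvC hvc hvcone _ hMs hvM
  have hnn : 0 ≤ ∫ z in K, (mixedDisc S (twistMatrix g v z) (g.coeff z)).re :=
    setIntegral_nonneg hK.measurableSet fun z hz => (hvcone z (hKW hz)).nonneg S (by omega)
  have hre : ∀ z, (mixedDisc S (∑ j ∈ T, twistMatrix g (w j) z) (g.coeff z)).re =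
      (T.card : ℝ) ^ k * (mixedDisc S (twistMatrix g v z) (g.coeff z)).re := fun z => by
    rw [hsum, mixedDisc_smul, hS, ← Complex.ofReal_natCast, ← Complex.ofReal_pow,
      Complex.re_ofReal_mul]
  simp only [hre]
  rw [integral_const_mul, abs_of_nonneg (by positivity)]
  rw [hS] at hle
  have hTn : (T.card : ℝ) ≤ n + 1 := by
    have := T.card_le_univ
    rw [Fintype.card_fin] at this
    exact_mod_cast (by omega : T.card ≤ n + 1)
  have hTk : (T.card : ℝ) ^ k ≤ (n + 1 : ℝ) ^ n :=
    (pow_le_pow_left₀ hTR.le hTn k).trans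
      (pow_le_pow_right₀ (by linarith [(Nat.cast_nonneg n : (0 : ℝ) ≤ n)]) (hkm.trans hm))
  calc 2 ^ n * ((T.card : ℝ) ^ k * ∫ z in K, (mixedDisc S (twistMatrix g v z) (g.coeff z)).re)
      ≤ 2 ^ n * ((n + 1 : ℝ) ^ n * (C * (1 + ∑ j, M j) ^ k)) := by gcongr
    _ = _ := by ring

/-- The estimate for several functions of class `C²` with compact support in the whole space, from
the estimate for their averages and polarization. -/
theorem setIntegral_density_prod_le (g : HermitianMetric n) {K W : Set (Fin n → ℂ)}
    (hK : IsCompact K) (hKW : K ⊆ W) {k m : ℕ} (hk : 1 ≤ k) (hkm : k ≤ m) (hm : m ≤ n)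
    {S : Finset (Fin n)} (hS : S.card = k) {C : ℝ} (hC0 : 0 < C)
    (hC : ∀ v : (Fin n → ℂ) → ℂ, ContDiff ℝ 2 v → HasCompactSupport v →
      (∀ z ∈ W, InCone (g.coeff z) m (twistMatrix g v z)) →
      ∀ M : ℝ, 0 ≤ M → (∀ᵐ z ∂volume.restrict W, ‖v z‖ ≤ M) →
      ∫ z in K, (mixedDisc S (twistMatrix g v z) (g.coeff z)).re ≤ C * (1 + M) ^ S.card)
    {w : Fin k → (Fin n → ℂ) → ℂ} (hw : ∀ j, ContDiff ℝ 2 (w j))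
    (hwc : ∀ j, HasCompactSupport (w j))
    (hcone : ∀ j, ∀ z ∈ W, InCone (g.coeff z) m (twistMatrix g (w j) z))
    {M : Fin k → ℝ} (hM0 : ∀ j, 0 ≤ M j) (hM : ∀ j, ∀ᵐ z ∂volume.restrict W, ‖w j z‖ ≤ M j) :
    ∫ z in K, density ((List.ofFn fun j => form11 (twistMatrix g (w j) z)).prod *
        g.form z ^ (n - k)) ≤
      2 ^ n * (2 ^ n * (n + 1) ^ n * C) * (1 + ∑ j, M j) ^ k := by
  set D : Finset (Fin k) → (Fin n → ℂ) → ℝ := fun T z =>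
    density (form11 (∑ j ∈ T, twistMatrix g (w j) z) ^ k * g.form z ^ (n - k)) with hD
  have hDcont : ∀ T, Continuous (D T) := by
    intro T
    simp only [hD, HermitianMetric.form, density_pow_mul_pow hS]
    refine continuous_const.mul (continuous_mixedDisc (fun a b => ?_) g.continuous_coeff S)
    simp only [Matrix.sum_apply]
    exact continuous_finsetSum _ fun j _ => continuous_twistMatrix g (hw j) a b
  have hMs : 0 ≤ ∑ j, M j := Finset.sum_nonneg fun j _ => hM0 j
  set Q : ℝ := 2 ^ n * (n + 1) ^ n * C * (1 + ∑ j, M j) ^ k with hQ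
  have hQ0 : 0 ≤ Q := by positivity
  have hT : ∀ T, |∫ z in K, D T z| ≤ Q := fun T =>
    abs_setIntegral_density_sum_le g hK hKW hk hkm hm hS hC0 hC hw hwc hcone hM0 hM T
  set J : ℝ := ∫ z in K, density ((List.ofFn fun j => form11 (twistMatrix g (w j) z)).prod *
        g.form z ^ (n - k)) with hJ
  have hpol : (k.factorial : ℝ) * J = ∑ T : Finset (Fin k), (-1 : ℝ) ^ Tᶜ.card *
      ∫ z in K, D T z := by
    rw [hJ, ← integral_const_mul]
    simp only [factorial_mul_density_prod]
    rw [integral_finsetSum _ fun T _ => (((hDcont T).continuousOn.integrableOn_compact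
      hK).const_mul _)]
    exact Finset.sum_congr rfl fun T _ => integral_const_mul _ _
  have hJk : (k.factorial : ℝ) * J ≤ 2 ^ n * Q := by
    rw [hpol]
    calc ∑ T : Finset (Fin k), (-1 : ℝ) ^ Tᶜ.card * ∫ z in K, D T z
        ≤ ∑ _T : Finset (Fin k), Q := Finset.sum_le_sum fun T _ => by
          refine (le_abs_self _).trans ?_
          rw [abs_mul, abs_pow, abs_neg, abs_one, one_pow, one_mul]
          exact hT T
      _ = 2 ^ k * Q := by simp
      _ ≤ 2 ^ n * Q := mul_le_mul_of_nonneg_right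
          (pow_le_pow_right₀ one_le_two (hkm.trans hm)) hQ0
  -- For `J ≤ 0` the bound is trivial, and for `J ≥ 0` the factor `k!` can be dropped.
  have hfac : (1 : ℝ) ≤ k.factorial := by exact_mod_cast k.factorial_pos
  have hfin : J ≤ 2 ^ n * Q := by
    rcases le_total J 0 with h | h
    · exact h.trans (by positivity)
    · exact (le_mul_of_one_le_left h hfac).trans hJk
  calc J ≤ 2 ^ n * Q := hfin
    _ = _ := by rw [hQ]; ring

end Polarization

end CLN

end

theorem mainTheorem11 (n : ℕ) (g : CLN.HermitianMetric n) (K U : Set (Fin n → ℂ))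
    (hK : IsCompact K) (hU : IsOpen U) (hKU : K ⊆ U) (hUc : IsCompact (closure U)) :
    ∃ C : ℝ, 0 < C ∧
      ∀ m k : ℕ, 1 ≤ k → k ≤ m → m < n →
      ∀ Ω : Set (Fin n → ℂ), IsOpen Ω → closure U ⊆ Ω →
      ∀ u : Fin k → (Fin n → ℂ) → ℝ, (∀ j, CLN.IsC2Subharmonic g m Ω (u j)) →
        CLN.integralForm K
            (fun z => (List.ofFn fun j => g.twist (u j) z).prod * g.form z ^ (n - k))
          ≤ C * (1 + ∑ j, CLN.supNorm U (u j)) ^ k := by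
  -- The functions are cut off between `W` and `U`, so that they are defined on the whole space and
  -- unchanged on `W`; the local estimate is applied in `W`.
  obtain ⟨W, hW, hKW, hWU, hWc⟩ := exists_open_between_and_isCompact_closure hK hU hKU
  obtain ⟨χ, hχ, hχc, hχU, hχ01, hχ1⟩ := CLN.exists_smooth_cutoff hWc hU hWU
  choose C hC0 hC using fun S => CLN.exists_setIntegral_mixedDisc_le g S hK hW hKW
  have hCs : 0 < ∑ S, C S := Finset.sum_pos (fun S _ => hC0 S) Finset.univ_nonempty
  refine ⟨2 ^ n * (2 ^ n * (n + 1) ^ n * ∑ S, C S), by positivity, ?_⟩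
  intro m k hk hkm hmn Ω hΩ hUΩ u hu
  obtain ⟨S, -, hS⟩ := Finset.exists_subset_card_eq
    (show k ≤ (Finset.univ : Finset (Fin n)).card by rw [Finset.card_fin]; omega)
  have hSm : S.card ≤ m := by omega
  have hχΩ : tsupport χ ⊆ Ω := hχU.trans (subset_closure.trans hUΩ)
  set w : Fin k → (Fin n → ℂ) → ℂ := fun j z => ((χ z * u j z : ℝ) : ℂ) with hw
  have hwC : ∀ j, ContDiff ℝ 2 (w j) := fun j =>
    CLN.contDiff_cutoff_mul hχ hΩ hχΩ (hu j).contDiffOn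
  have hwc : ∀ j, HasCompactSupport (w j) := fun j =>
    (hχc.mul_right (f' := u j)).comp_left Complex.ofReal_zero
  have htwist : ∀ j, ∀ z ∈ W, g.twist (u j) z = CLN.form11 (CLN.twistMatrix g (w j) z) := by
    intro j z hz
    rw [CLN.twist_eq_form11]
    congr 1
    ext a b
    simp only [CLN.twistMatrix, Matrix.of_apply]
    rw [CLN.hess_congr (f := fun y => (u j y : ℂ)) (g := w j)]
    filter_upwards [hχ1 z (subset_closure hz)] with y hy
    simp [hw, hy]
  have hcone : ∀ j, ∀ z ∈ W, CLN.InCone (g.coeff z) m (CLN.twistMatrix g (w j) z) := by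
    intro j z hz
    refine CLN.inCone_of_density_nonneg (g.posDef z)
      (CLN.isHermitian_twistMatrix g (hwC j) (fun y => Complex.conj_ofReal _) z)
      fun l hl hlm => ?_
    rw [← htwist j z hz]
    exact (hu j).nonneg l hl hlm z (hUΩ (subset_closure (hWU (subset_closure hz))))
  have hM : ∀ j, ∀ᵐ z ∂volume.restrict W, ‖w j z‖ ≤ CLN.supNorm U (u j) := by
    intro j
    filter_upwards [ae_restrict_of_ae_restrict_of_subset (subset_closure.trans hWU)
      (CLN.ae_abs_le_supNorm hU hUc hUΩ (hu j).contDiffOn.continuousOn)] with z hz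
    simp only [hw, Complex.norm_real, Real.norm_eq_abs, abs_mul, abs_of_nonneg (hχ01 z).1]
    exact (mul_le_of_le_one_left (abs_nonneg _) (hχ01 z).2).trans hz
  have hmain := CLN.setIntegral_density_prod_le g hK hKW hk hkm hmn.le hS (hC0 S)
    (fun v => hC S m hSm hmn.le v) hwC hwc hcone (fun j => CLN.supNorm_nonneg U (u j)) hM
  have hint : CLN.integralForm K
      (fun z => (List.ofFn fun j => g.twist (u j) z).prod * g.form z ^ (n - k)) =
      ∫ z in K, CLN.density ((List.ofFn fun j => CLN.form11 (CLN.twistMatrix g (w j) z)).prod *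
        g.form z ^ (n - k)) := by
    refine setIntegral_congr_fun hK.measurableSet fun z hz => ?_
    simp only [htwist _ z (hKW hz)]
  rw [hint]
  refine hmain.trans (mul_le_mul_of_nonneg_right ?_ ?_)
  · have := Finset.single_le_sum (f := C) (fun S _ => (hC0 S).le) (Finset.mem_univ S)
    gcongr
  · exact pow_nonneg (add_nonneg zero_le_one (Finset.sum_nonneg fun j _ =>
      CLN.supNorm_nonneg U (u j))) k
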